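/- Let $\mathfrak g$ be a finite-dimensional complex Lie algebra with a non-degenerate symmetric bilinear form $B$ that is invariant, $B([X,Y],Z)=-B(Y,[X,Z])$ (a quadratic Lie algebra), and let $F_0(X,Y)=[X,Y]$. We use the following notation. * $\mathcal M_a^k$ is the space of skew symmetric $k$-linear maps $\mathfrak g^k\to\mathfrak g$ (so $\mathcal M_a^0=\mathfrak g$). For $F\in\mathcal M_a^p$, $G\in\mathcal M_a^q$ the Gerstenhaber bracket $[F,G]_a\in\mathcal M_a^{p+q-1}$ is $(-1)^{(p-1)(q-1)}F\circ G-G\circ F$, where $$(F\circ G)(Y_1,\dots,Y_{p+q-1})=\sum_{\sigma\in\mathfrak S_{q,p-1}}\varepsilon(\sigma)\,F\big(G(Y_{\sigma(1)},\dots,Y_{\sigma(q)}),Y_{\sigma(q+1)},\dots,Y_{\sigma(p+q-1)}\big),$$ the sum being over $(q,p-1)$-unshuffles, and $F\circ G=0$ if $p=0$. Put $d=[F_0,\cdot]_a$. * $\bigwedge\mathfrak g=\bigoplus_k\bigwedge^k\mathfrak g$ is the algebra of skew symmetric multilinear forms on $\mathfrak g$, with the wedge product; $\iota_X\Omega=\Omega(X,\cdot,\dots,\cdot)$.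 Its differential $\partial$ is the one of the trivial cohomology of $\mathfrak g$, $\partial\Omega(Y_1,\dots,Y_{w+1})=\sum_{i<j}(-1)^{i+j}\Omega([Y_i,Y_j],Y_1,\dots,\widehat{Y_i},\dots,\widehat{Y_j},\dots,Y_{w+1})$, and $H^*(\mathfrak g)$ is its cohomology. The super Poisson bracket is $\{\Omega,\Omega'\}=2(-1)^{w+1}\sum_j\iota_{X_j}\Omega\wedge\iota_{X_j}\Omega'$ for $\Omega\in\bigwedge^w\mathfrak g$ and any $B$-orthonormal basis $(X_j)$. * $C\in\mathcal M_a^k$ is cyclic if $\hat C(Y_1,\dots,Y_{k+1}):=B(C(Y_1,\dots,Y_k),Y_{k+1})$ satisfies $\hat C(Y_1,\dots,Y_{k+1})=(-1)^k\hat C(Y_{k+1},Y_1,\dots,Y_k)$. Let $\mathcal C_c$ be the graded space of cyclic cochains. The map $\Phi(C)=-\tfrac12\hat C$ is a bijection from $\mathcal C_c$ onto $\bigwedge_+\mathfrak g=\bigoplus_{k\ge1}\bigwedge^k\mathfrak g$, and one sets $C\wedge C'=\Phi^{-1}(\Phi(C)\wedge\Phi(C'))$. Then $d$ maps $\mathcal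 C_c$ to itself and $d^2=0$ on $\mathcal C_c$, and $\partial^2=0$; let $H_c^*(\mathfrak g)$ (the cyclic cohomology) be the cohomology of $(\mathcal C_c,d)$. The products $\wedge$ and $[\cdot,\cdot]_a$ on $\mathcal C_c$ induce products on $H_c^*(\mathfrak g)$; the wedge product and the super Poisson bracket on $\bigwedge\mathfrak g$ induce products on $H^*(\mathfrak g)$, hence a wedge product on $H_+^*(\mathfrak g)=\sum_{k\ge1}H^k(\mathfrak g)$ and a bracket on $H_Q^*(\mathfrak g)=H^*(\mathfrak g)/\mathbb C$, where $\mathbb C=H^0(\mathfrak g)$. With these, and with $V[s]^n=V^{n+s}$: 1. $H_c^*(\mathfrak g)[-1]$ and $H_+^*(\mathfrak g)$, with the wedge products, are graded associative algebras (without unit), and $\Phi$ induces an isomorphism of graded associative algebras $\Phi^*\colon H_c^*(\mathfrak g)[-1]\to H_+^*(\mathfrak g)$. 2. $H_c^*(\mathfrak g)[1]$, with the Gerstenhaber bracket, and $H_Q^*(\mathfrak g)[2]$, with the super Poisson bracket, are graded Lie algebras, and the composition of $\Phi^*$ with the canonical map $H^*(\mathfrak g)\to H_Q^*(\mathfrak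 g)$ is an isomorphism of graded Lie algebras $H_c^*(\mathfrak g)[1]\to H_Q^*(\mathfrak g)[2]$. -/

import Mathlib

open scoped DirectSum

noncomputable section

namespace QuadraticLie

/-! ### Direct sums of vector spaces indexed by `ℕ` -/

section GrSum

/-- The direct sum of a sequence of complex vector spaces. -/
def GrSum (M : ℕ → Type*) [∀ k, AddCommGroup (M k)] [∀ k, Module ℂ (M k)] : Type _ := ⨁ k, M k

variable {M : ℕ → Type*} [∀ k, AddCommGroup (M k)] [∀ k, Module ℂ (M k)]

instance : AddCommGroup (GrSum M) := inferInstanceAs (AddCommGroup (⨁ k, M k))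

instance : Module ℂ (GrSum M) := inferInstanceAs (Module ℂ (⨁ k, M k))

/-- The inclusion of the homogeneous elements of degree `k`. -/
def incl (M : ℕ → Type*) [∀ k, AddCommGroup (M k)] [∀ k, Module ℂ (M k)] (k : ℕ) :
    M k →ₗ[ℂ] GrSum M :=
  DirectSum.lof ℂ ℕ M k

/-- The linear map on the direct sum given by its values on homogeneous elements. -/
def lift {X : Type*} [AddCommGroup X] [Module ℂ X] (f : ∀ k, M k →ₗ[ℂ] X) : GrSum M →ₗ[ℂ] X :=
  DirectSum.toModule ℂ ℕ X f

/-- The homogeneous component of degree `k`. -/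
def coord (M : ℕ → Type*) [∀ k, AddCommGroup (M k)] [∀ k, Module ℂ (M k)] (k : ℕ) :
    GrSum M →ₗ[ℂ] M k :=
  DirectSum.component ℂ ℕ M k

@[simp]
theorem lift_incl {X : Type*} [AddCommGroup X] [Module ℂ X] (f : ∀ k, M k →ₗ[ℂ] X) (k : ℕ)
    (a : M k) : lift f (incl M k a) = f k a :=
  DirectSum.toModule_lof ℂ k a

theorem coord_incl_self (k : ℕ) (a : M k) : coord M k (incl M k a) = a :=
  DirectSum.component.lof_self ℂ (M := M) k a

theorem coord_incl_ne {j k : ℕ} (h : j ≠ k) (a : M j) : coord M k (incl M j a) = 0 :=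
  DirectSum.of_eq_of_ne _ _ _ h.symm

theorem linearMap_ext {X : Type*} [AddCommGroup X] [Module ℂ X] {f f' : GrSum M →ₗ[ℂ] X}
    (h : ∀ k (a : M k), f (incl M k a) = f' (incl M k a)) : f = f' :=
  DirectSum.linearMap_ext ℂ fun k => LinearMap.ext (h k)

/-- The part of degree `n : ℤ` of a direct sum indexed by `ℕ` (zero if `n < 0`). -/
def degPart (M : ℕ → Type*) [∀ k, AddCommGroup (M k)] [∀ k, Module ℂ (M k)] (n : ℤ) :
    Submodule ℂ (GrSum M) :=
  ⨆ (k : ℕ) (_ : (k : ℤ) = n), LinearMap.range (incl M k)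

end GrSum

/-! ### Skew symmetric multilinear maps with values in a vector space -/

/-- The graded space of skew symmetric multilinear maps from `V` to `W`. For `W = ℂ` it is the
Grassmann algebra of `V`; for `W = V` it is the space of skew symmetric elements
of the Gerstenhaber algebra. -/
abbrev Alt (V W : Type*) [AddCommGroup V] [Module ℂ V] [AddCommGroup W] [Module ℂ W] : Type _ :=
  GrSum fun k : ℕ => V [⋀^Fin k]→ₗ[ℂ] W

section Alt

variable {V W W₁ W₂ W₃ : Type*} [AddCommGroup V] [Module ℂ V] [AddCommGroup W] [Module ℂ W]
  [AddCommGroup W₁] [Module ℂ W₁] [AddCommGroup W₂] [Module ℂ W₂] [AddCommGroup W₃] [Module ℂ W₃]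

/-- The inclusion of the homogeneous elements of degree `k`. -/
abbrev hom (V W : Type*) [AddCommGroup V] [Module ℂ V] [AddCommGroup W] [Module ℂ W] (k : ℕ) :
    (V [⋀^Fin k]→ₗ[ℂ] W) →ₗ[ℂ] Alt V W :=
  incl (fun k : ℕ => V [⋀^Fin k]→ₗ[ℂ] W) k

/-- The bilinear extension to `Alt V W₁ × Alt V W₂` of a family of bilinear maps given on
homogeneous elements. -/
def bilinExt {X : Type*} [AddCommGroup X] [Module ℂ X]
    (f : ∀ p q : ℕ, (V [⋀^Fin p]→ₗ[ℂ] W₁) →ₗ[ℂ] (V [⋀^Fin q]→ₗ[ℂ] W₂) →ₗ[ℂ] X) :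
    Alt V W₁ →ₗ[ℂ] Alt V W₂ →ₗ[ℂ] X :=
  lift fun p => LinearMap.flip <|
    lift fun q => (f p q).flip

theorem bilinExt_hom {X : Type*} [AddCommGroup X] [Module ℂ X]
    (f : ∀ p q : ℕ, (V [⋀^Fin p]→ₗ[ℂ] W₁) →ₗ[ℂ] (V [⋀^Fin q]→ₗ[ℂ] W₂) →ₗ[ℂ] X)
    (p q : ℕ) (a : V [⋀^Fin p]→ₗ[ℂ] W₁) (b : V [⋀^Fin q]→ₗ[ℂ] W₂) :
    bilinExt f (hom V W₁ p a) (hom V W₂ q b) = f p q a b := by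
  simp [bilinExt]

/-- The shuffle product of `a` and `b` along a bilinear map `μ`:
the sum over all `(p,q)`-unshuffles `σ` of
`ε(σ) μ (a (Y_σ(1), …, Y_σ(p))) (b (Y_σ(p+1), …, Y_σ(p+q)))`. -/
def shuffle (μ : W₁ →ₗ[ℂ] W₂ →ₗ[ℂ] W₃) (p q : ℕ) :
    (V [⋀^Fin p]→ₗ[ℂ] W₁) →ₗ[ℂ] (V [⋀^Fin q]→ₗ[ℂ] W₂) →ₗ[ℂ] (V [⋀^Fin (p + q)]→ₗ[ℂ] W₃) :=
  TensorProduct.curry <|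
    (AlternatingMap.domDomCongrₗ ℂ finSumFinEquiv).toLinearMap ∘ₗ
      (LinearMap.compAlternatingMapₗ ℂ (TensorProduct.lift μ)) ∘ₗ
        AlternatingMap.domCoprod'

/-- The shuffle product along `μ` on the total spaces. -/
def shuffleProd (μ : W₁ →ₗ[ℂ] W₂ →ₗ[ℂ] W₃) : Alt V W₁ →ₗ[ℂ] Alt V W₂ →ₗ[ℂ] Alt V W₃ :=
  bilinExt fun p q => (shuffle μ p q).compr₂ (hom V W₃ (p + q))

/-- `slot F (Y_1, …, Y_k)` is the linear map `X ↦ F (X, Y_1, …, Y_k)`. -/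
def slot (k : ℕ) : (V [⋀^Fin (k + 1)]→ₗ[ℂ] W) →ₗ[ℂ] (V [⋀^Fin k]→ₗ[ℂ] (V →ₗ[ℂ] W)) where
  toFun F :=
    { toFun := fun Y =>
        { toFun := fun X => F.curryLeft X Y
          map_add' := fun X X' => by rw [map_add, AlternatingMap.add_apply]
          map_smul' := fun c X => by rw [map_smul, AlternatingMap.smul_apply]; rfl }
      map_update_add' := fun Y i x y => by
        ext X
        exact (F.curryLeft X).map_update_add Y i x y
      map_update_smul' := fun Y i c x => by
        ext X
        exact (F.curryLeft X).map_update_smul Y i c x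
      map_eq_zero_of_eq' := fun Y i j h hij => by
        ext X
        exact (F.curryLeft X).map_eq_zero_of_eq Y h hij }
  map_add' F G := by ext; rfl
  map_smul' c F := by ext; rfl

/-- `slot` on the total space (zero in degree `0`). -/
def slotTot : Alt V W →ₗ[ℂ] Alt V (V →ₗ[ℂ] W) :=
  lift fun k => match k with
    | 0 => 0
    | k + 1 => hom V (V →ₗ[ℂ] W) k ∘ₗ slot k

/-- Evaluation, with the argument first. -/
def evalAt : V →ₗ[ℂ] (V →ₗ[ℂ] W) →ₗ[ℂ] W := LinearMap.applyₗ

/-- Insertion of `G` into the first slot of `F`, skew symmetrized: for `F` of degree `p + 1`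
and `G` of degree `q`, the sum over all `(q,p)`-unshuffles `σ` of
`ε(σ) F (G (Y_σ(1), …, Y_σ(q)), Y_σ(q+1), …, Y_σ(q+p))`; zero if `F` has degree `0`. -/
def insertion : Alt V W →ₗ[ℂ] Alt V V →ₗ[ℂ] Alt V W :=
  ((shuffleProd (V := V) evalAt).flip ∘ₗ slotTot)

/-- The wedge product on the Grassmann algebra of skew symmetric multilinear forms. -/
def wedge : Alt V ℂ →ₗ[ℂ] Alt V ℂ →ₗ[ℂ] Alt V ℂ := shuffleProd (LinearMap.mul ℂ ℂ)

/-- The Gerstenhaber (Nijenhuis-Richardson) bracket: if `F` has `p` arguments and `G` has `q`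
arguments, it is `(-1)^((p-1)(q-1)) F ∘ G - G ∘ F` (recall that `p + 1` and `p - 1` have
the same parity). -/
def gerstenhaber : Alt V V →ₗ[ℂ] Alt V V →ₗ[ℂ] Alt V V :=
  bilinExt fun p q =>
    (-1 : ℂ) ^ ((p + 1) * (q + 1)) • insertion.compl₁₂ (hom V V p) (hom V V q)
      - insertion.flip.compl₁₂ (hom V V p) (hom V V q)

/-- The derivation `ι_X` of the Grassmann algebra: insertion of `X` as the first argument. -/
def contract (X : V) : Alt V ℂ →ₗ[ℂ] Alt V ℂ :=
  lift fun k => match k with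
    | 0 => 0
    | k + 1 => hom V ℂ k ∘ₗ AlternatingMap.curryLeftLinearMap.flip X

theorem contract_add (X Y : V) : contract (X + Y) = contract X + contract Y := by
  refine linearMap_ext fun k a => ?_
  cases k <;> simp [contract]

theorem contract_smul (c : ℂ) (X : V) : contract (c • X) = c • contract X := by
  refine linearMap_ext fun k a => ?_
  cases k <;> simp [contract]

/-- The operator multiplying a homogeneous element of degree `w` by `(-1)^(w+1)`. -/
def signOp : Alt V ℂ →ₗ[ℂ] Alt V ℂ :=
  lift fun w => (-1 : ℂ) ^ (w + 1) • hom V ℂ w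

end Alt

section SuperPoisson

variable {V : Type*} [AddCommGroup V] [Module ℂ V] [FiniteDimensional ℂ V]

/-- The super Poisson bracket on the Grassmann algebra of a quadratic vector space: for `Ω` of
degree `w`, `{Ω, Ω'} = 2 (-1)^(w+1) ∑ j, ι_{X_j} Ω ∧ ι_{X'_j} Ω'`, where `X` is any basis and `X'`
its `B`-dual basis. -/
def superPoisson (B : LinearMap.BilinForm ℂ V) (hB : B.Nondegenerate) :
    Alt V ℂ →ₗ[ℂ] Alt V ℂ →ₗ[ℂ] Alt V ℂ :=
  (2 : ℂ) • ∑ j, (wedge.compl₁₂ (contract (Module.finBasis ℂ V j))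
    (contract (B.dualBasis hB (Module.finBasis ℂ V) j))) ∘ₗ signOp

/-- In an orthonormal basis the super Poisson bracket is
`{Ω, Ω'} = 2 (-1)^(w+1) ∑ j, ι_{X_j} Ω ∧ ι_{X_j} Ω'`. -/
theorem superPoisson_orthonormal (B : LinearMap.BilinForm ℂ V) (hB : B.Nondegenerate)
    {n : ℕ} (X : Module.Basis (Fin n) ℂ V) (hX : ∀ i j, B (X i) (X j) = if i = j then 1 else 0)
    (w : ℕ) (Ω : V [⋀^Fin w]→ₗ[ℂ] ℂ) (Ω' : Alt V ℂ) :
    superPoisson B hB (hom V ℂ w Ω) Ω' =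
      (2 * (-1 : ℂ) ^ (w + 1)) •
        ∑ j, wedge (contract (X j) (hom V ℂ w Ω)) (contract (X j) Ω') := by
  have key : ∀ f : V →ₗ[ℂ] V →ₗ[ℂ] Alt V ℂ,
      ∑ j, f (Module.finBasis ℂ V j) (B.dualBasis hB (Module.finBasis ℂ V) j)
        = ∑ i, f (X i) (X i) := by
    intro f
    have h1 : ∀ v, v = ∑ i, B v (X i) • X i := by
      intro v
      have h2 := X.sum_repr v
      have h3 : ∀ i, B v (X i) = X.repr v i := by
        intro i
        conv_lhs => rw [← h2, map_sum, LinearMap.sum_apply]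
        simp [hX]
      simp only [h3]
      exact h2.symm
    have h4 : ∀ v, v = ∑ j, B v (Module.finBasis ℂ V j) •
        B.dualBasis hB (Module.finBasis ℂ V) j := by
      intro v
      have h2 := (B.dualBasis hB (Module.finBasis ℂ V)).sum_repr v
      simp only [LinearMap.BilinForm.dualBasis_repr_apply] at h2
      exact h2.symm
    have h5 : ∀ u v, B u v = B v u := by
      intro u v
      rw [h1 u, h1 v]
      simp only [map_sum, map_smul, LinearMap.sum_apply, LinearMap.smul_apply, hX, smul_eq_mul]
      simp [mul_comm]
    calc _ = ∑ j, ∑ i, B (Module.finBasis ℂ V j) (X i) •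
              f (X i) (B.dualBasis hB (Module.finBasis ℂ V) j) := by
            refine Finset.sum_congr rfl fun j _ => ?_
            conv_lhs => rw [h1 (Module.finBasis ℂ V j)]
            simp
      _ = ∑ i, ∑ j, B (X i) (Module.finBasis ℂ V j) •
              f (X i) (B.dualBasis hB (Module.finBasis ℂ V) j) := by
            rw [Finset.sum_comm]
            simp only [h5]
      _ = _ := by
            refine Finset.sum_congr rfl fun i _ => ?_
            conv_rhs => arg 2; rw [h4 (X i)]
            rw [map_sum]
            simp
  have h := key (LinearMap.mk₂ ℂ
    (fun x y => wedge (contract x (hom V ℂ w Ω)) (contract y Ω'))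
    (fun a b c => by simp [contract_add]) (fun a b c => by simp [contract_smul])
    (fun a b c => by simp [contract_add]) (fun a b c => by simp [contract_smul]))
  simp only [LinearMap.mk₂_apply] at h
  rw [← h]
  simp [superPoisson, signOp, Finset.smul_sum, smul_smul]

end SuperPoisson

/-! ### Cyclic cochains of a quadratic vector space -/

section Cyclic

variable {V : Type*} [AddCommGroup V] [Module ℂ V]

/-- `hat B C (Y_1, …, Y_{k+1}) = B (C (Y_1, …, Y_k)) Y_{k+1}`. -/
def hat (B : LinearMap.BilinForm ℂ V) {k : ℕ} (C : V [⋀^Fin k]→ₗ[ℂ] V) :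
    MultilinearMap ℂ (fun _ : Fin (k + 1) => V) ℂ :=
  (B.compMultilinearMap C.toMultilinearMap).uncurryRight

theorem hat_apply (B : LinearMap.BilinForm ℂ V) {k : ℕ} (C : V [⋀^Fin k]→ₗ[ℂ] V)
    (Y : Fin (k + 1) → V) : hat B C Y = B (C (Fin.init Y)) (Y (Fin.last k)) := rfl

/-- The cyclic cochains of degree `k`:
`Ĉ (Y_1, …, Y_{k+1}) = (-1)^k Ĉ (Y_{k+1}, Y_1, …, Y_k)`. -/
def cyc (B : LinearMap.BilinForm ℂ V) (k : ℕ) : Submodule ℂ (V [⋀^Fin k]→ₗ[ℂ] V) where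
  carrier := {C | ∀ Y : Fin (k + 1) → V,
    hat B C Y = (-1) ^ k * hat B C (Fin.cons (Y (Fin.last k)) (Fin.init Y))}
  add_mem' {C C'} h h' Y := by
    have e : ∀ Z, hat B (C + C') Z = hat B C Z + hat B C' Z := fun Z => by simp [hat_apply]
    rw [e, e, h Y, h' Y, mul_add]
  zero_mem' Y := by simp [hat_apply]
  smul_mem' c C h Y := by
    have e : ∀ Z, hat B (c • C) Z = c * hat B C Z := fun Z => by simp [hat_apply]
    rw [e, e, h Y]
    ring

/-- The graded space of cyclic cochains. -/
abbrev Cyc (B : LinearMap.BilinForm ℂ V) : Type _ := GrSum fun k : ℕ => cyc B k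

/-- The inclusion of the homogeneous cyclic cochains of degree `k`. -/
abbrev cycHom (B : LinearMap.BilinForm ℂ V) (k : ℕ) : cyc B k →ₗ[ℂ] Cyc B :=
  incl (fun k : ℕ => cyc B k) k

/-- The inclusion of the space of cyclic cochains into the space of all cochains. -/
def cycIncl (B : LinearMap.BilinForm ℂ V) : Cyc B →ₗ[ℂ] Alt V V :=
  lift fun k => hom V V k ∘ₗ (cyc B k).subtype

theorem hat_eq_zero (B : LinearMap.BilinForm ℂ V) {k : ℕ} {C : V [⋀^Fin k]→ₗ[ℂ] V}
    (hC : C ∈ cyc B k) (Y : Fin (k + 1) → V) (i j : Fin (k + 1)) (h : Y i = Y j) (hij : i ≠ j) :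
    hat B C Y = 0 := by
  have base : ∀ (Z : Fin (k + 1) → V) (a b : Fin k), Z a.castSucc = Z b.castSucc → a ≠ b →
      hat B C Z = 0 := by
    intro Z a b hab hne
    rw [hat_apply, C.map_eq_zero_of_eq (Fin.init Z) (i := a) (j := b) hab hne]
    simp
  have edge : ∀ (Z : Fin (k + 1) → V) (a : Fin k), Z a.castSucc = Z (Fin.last k) →
      hat B C Z = 0 := by
    intro Z a ha
    cases k with
    | zero => exact a.elim0
    | succ m =>
      rw [hC Z]
      induction a using Fin.lastCases with
      | cast b =>
        rw [base _ 0 b.succ _ (Fin.succ_ne_zero b).symm, mul_zero]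
        have e1 : (b.succ : Fin (m + 1)).castSucc = (b.castSucc : Fin (m + 1)).succ := rfl
        rw [e1, Fin.castSucc_zero, Fin.cons_zero, Fin.cons_succ]
        exact ha.symm
      | last =>
        cases m with
        | zero =>
          have e : (Fin.cons (Z (Fin.last 1)) (Fin.init Z) : Fin 2 → V) = Z := by
            ext t
            fin_cases t
            · exact ha.symm
            · exact ha
          have h1 := hC Z
          rw [e] at h1 ⊢
          have h2 : hat B C Z = 0 := by linear_combination (1 / 2) * h1
          rw [h2, mul_zero]
        | succ r =>
          rw [hC, base _ 0 1 _ (by simp), mul_zero, mul_zero]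
          have e0 : (1 : Fin (r + 2)).castSucc = (0 : Fin (r + 2)).succ := rfl
          rw [e0, Fin.castSucc_zero, Fin.cons_zero, Fin.cons_succ]
          have e1 : (Fin.last (r + 1 + 1)) = (Fin.last (r + 1)).succ := rfl
          rw [e1, Fin.cons_succ]
          exact ha
  induction i using Fin.lastCases with
  | last =>
    induction j using Fin.lastCases with
    | last => exact absurd rfl hij
    | cast b => exact edge Y b h.symm
  | cast a =>
    induction j using Fin.lastCases with
    | last => exact edge Y a h
    | cast b => exact base Y a b h fun e => hij (by rw [e])

/-- The map `Θ : C ↦ Ĉ`, from cyclic cochains of degree `k` to forms of degree `k + 1`. -/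
def theta (B : LinearMap.BilinForm ℂ V) (k : ℕ) : cyc B k →ₗ[ℂ] (V [⋀^Fin (k + 1)]→ₗ[ℂ] ℂ) where
  toFun C := { hat B C.1 with
    map_eq_zero_of_eq' := fun Y i j h hij => hat_eq_zero B C.2 Y i j h hij }
  map_add' C C' := by
    ext Y
    change hat B (C + C').1 Y = hat B C.1 Y + hat B C'.1 Y
    simp [hat_apply]
  map_smul' c C := by
    ext Y
    change hat B (c • C).1 Y = c * hat B C.1 Y
    simp [hat_apply]

theorem theta_apply (B : LinearMap.BilinForm ℂ V) (k : ℕ) (C : cyc B k) (Y : Fin (k + 1) → V) :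
    theta B k C Y = B (C.1 (Fin.init Y)) (Y (Fin.last k)) := rfl

/-- The map `Φ = -(1/2) Θ` from cyclic cochains to the Grassmann algebra. -/
def Phi (B : LinearMap.BilinForm ℂ V) : Cyc B →ₗ[ℂ] Alt V ℂ :=
  lift fun k => (-(1 / 2) : ℂ) • (hom V ℂ (k + 1) ∘ₗ theta B k)

theorem map_rotate {k : ℕ} (Ω : V [⋀^Fin (k + 1)]→ₗ[ℂ] ℂ) (Y : Fin (k + 1) → V) :
    Ω (Fin.cons (Y (Fin.last k)) (Fin.init Y)) = (-1) ^ k * Ω Y := by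
  have e : (Fin.cons (Y (Fin.last k)) (Fin.init Y) : Fin (k + 1) → V) ∘ finRotate (k + 1) = Y := by
    ext i
    induction i using Fin.lastCases with
    | last => simp
    | cast j =>
      have : finRotate (k + 1) j.castSucc = j.succ := by simp
      simp only [Function.comp_apply, this, Fin.cons_succ]
      rfl
  have h := Ω.map_perm (Fin.cons (Y (Fin.last k)) (Fin.init Y)) (finRotate (k + 1))
  rw [e, sign_finRotate] at h
  rw [h]
  simp only [Units.smul_def, Units.val_pow_eq_pow_val, Units.val_neg, Units.val_one,
    zsmul_eq_mul, Int.cast_pow, Int.cast_neg, Int.cast_one]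
  rw [Nat.add_sub_cancel, ← mul_assoc, ← mul_pow]
  simp

theorem theta_injective (B : LinearMap.BilinForm ℂ V) (hB : B.Nondegenerate) (k : ℕ) :
    Function.Injective (theta B k) := by
  rw [← LinearMap.ker_eq_bot, LinearMap.ker_eq_bot']
  intro C h
  ext Y
  refine hB.1 _ fun z => ?_
  have h2 := DFunLike.congr_fun h (Fin.snoc Y z : Fin (k + 1) → V)
  rw [theta_apply] at h2
  simpa using h2

variable [FiniteDimensional ℂ V]

/-- The cochain `C` with `B (C (Y_1, …, Y_k)) Y = Ω (Y_1, …, Y_k, Y)`. -/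
def dualize (B : LinearMap.BilinForm ℂ V) (hB : B.Nondegenerate) (k : ℕ) :
    (V [⋀^Fin (k + 1)]→ₗ[ℂ] ℂ) →ₗ[ℂ] (V [⋀^Fin k]→ₗ[ℂ] V) :=
  (-1 : ℂ) ^ k • (LinearMap.compAlternatingMapₗ ℂ (B.toDual hB).symm.toLinearMap ∘ₗ slot k)

theorem hat_dualize (B : LinearMap.BilinForm ℂ V) (hB : B.Nondegenerate) (k : ℕ)
    (Ω : V [⋀^Fin (k + 1)]→ₗ[ℂ] ℂ) (Y : Fin (k + 1) → V) : hat B (dualize B hB k Ω) Y = Ω Y := by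
  have h2 : B ((B.toDual hB).symm (slot k Ω (Fin.init Y))) (Y (Fin.last k))
      = Ω (Fin.cons (Y (Fin.last k)) (Fin.init Y)) := by
    rw [LinearMap.BilinForm.apply_toDual_symm_apply]
    rfl
  rw [map_rotate] at h2
  rw [hat_apply]
  simp only [dualize, LinearMap.smul_apply, LinearMap.comp_apply, AlternatingMap.smul_apply,
    LinearMap.compAlternatingMapₗ_apply, LinearMap.compAlternatingMap_apply, map_smul, smul_eq_mul,
    LinearEquiv.coe_coe, h2]
  rw [← mul_assoc, ← mul_pow]
  simp

/-- The inverse of `Θ` in degree `k`. -/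
def thetaInv (B : LinearMap.BilinForm ℂ V) (hB : B.Nondegenerate) (k : ℕ) :
    (V [⋀^Fin (k + 1)]→ₗ[ℂ] ℂ) →ₗ[ℂ] cyc B k :=
  LinearMap.codRestrict (cyc B k) (dualize B hB k) fun Ω Y => by
    rw [hat_dualize, hat_dualize, map_rotate, ← mul_assoc, ← mul_pow]
    simp

theorem theta_thetaInv (B : LinearMap.BilinForm ℂ V) (hB : B.Nondegenerate) (k : ℕ)
    (Ω : V [⋀^Fin (k + 1)]→ₗ[ℂ] ℂ) : theta B k (thetaInv B hB k Ω) = Ω :=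
  AlternatingMap.ext fun Y => hat_dualize B hB k Ω Y

/-- The inverse of the bijection `Φ` from cyclic cochains onto the forms without constant term
(constants are sent to `0`). -/
def PhiInv (B : LinearMap.BilinForm ℂ V) (hB : B.Nondegenerate) : Alt V ℂ →ₗ[ℂ] Cyc B :=
  lift fun k => match k with
    | 0 => 0
    | k + 1 => (-2 : ℂ) • (cycHom B k ∘ₗ thetaInv B hB k)

theorem PhiInv_Phi (B : LinearMap.BilinForm ℂ V) (hB : B.Nondegenerate) (C : Cyc B) :
    PhiInv B hB (Phi B C) = C := by
  suffices h : PhiInv B hB ∘ₗ Phi B = LinearMap.id from LinearMap.congr_fun h C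
  refine linearMap_ext fun k C => ?_
  have e : thetaInv B hB k (theta B k C) = C :=
    theta_injective B hB k (theta_thetaInv B hB k _)
  simp [Phi, PhiInv, e, smul_smul]

theorem Phi_PhiInv (B : LinearMap.BilinForm ℂ V) (hB : B.Nondegenerate) (Ω : Alt V ℂ)
    (h0 : coord _ 0 Ω = 0) : Phi B (PhiInv B hB Ω) = Ω := by
  suffices h : Phi B ∘ₗ PhiInv B hB + hom V ℂ 0 ∘ₗ coord _ 0 = LinearMap.id by
    have h1 := LinearMap.congr_fun h Ω
    simpa [h0] using h1
  refine linearMap_ext fun k a => ?_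
  cases k with
  | zero =>
    have e := coord_incl_self (M := fun k : ℕ => V [⋀^Fin k]→ₗ[ℂ] ℂ) 0 a
    simp [PhiInv, e]
  | succ k =>
    have e := coord_incl_ne (M := fun k : ℕ => V [⋀^Fin k]→ₗ[ℂ] ℂ) (Nat.succ_ne_zero k) a
    simp [Phi, PhiInv, theta_thetaInv, e, smul_smul]

/-- The wedge product of cyclic cochains, `C ∧ C' = Φ⁻¹ (Φ C ∧ Φ C')`. -/
def cycWedge (B : LinearMap.BilinForm ℂ V) (hB : B.Nondegenerate) :
    Cyc B →ₗ[ℂ] Cyc B →ₗ[ℂ] Cyc B :=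
  (wedge.compl₁₂ (Phi B) (Phi B)).compr₂ (PhiInv B hB)

end Cyclic

/-! ### Cohomology of a subcomplex, its grading, and induced operations -/

section Cohomology

variable {C A : Type*} [AddCommGroup C] [Module ℂ C] [AddCommGroup A] [Module ℂ A]

/-- `d` is a differential on the subspace `C` of `A` (embedded by `i`): it maps `C` to itself, and
its square vanishes there. -/
structure IsSubcomplex (i : C →ₗ[ℂ] A) (d : A →ₗ[ℂ] A) : Prop where
  maps_to : ∀ c : C, d (i c) ∈ LinearMap.range i
  sq_zero : ∀ c : C, d (d (i c)) = 0

/-- The cocycles in `C`. -/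
abbrev cocycles (i : C →ₗ[ℂ] A) (d : A →ₗ[ℂ] A) : Submodule ℂ C := LinearMap.ker (d ∘ₗ i)

/-- The coboundaries of `C`: the elements of the form `d c` with `c` in `C`. -/
abbrev coboundaries (i : C →ₗ[ℂ] A) (d : A →ₗ[ℂ] A) : Submodule ℂ C :=
  (LinearMap.range (d ∘ₗ i)).comap i

/-- The cohomology of the subcomplex `C` of `A`. -/
abbrev Coh (i : C →ₗ[ℂ] A) (d : A →ₗ[ℂ] A) : Type _ :=
  cocycles i d ⧸ (coboundaries i d).submoduleOf (cocycles i d)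

/-- The class of a cocycle. -/
abbrev cls (i : C →ₗ[ℂ] A) (d : A →ₗ[ℂ] A) (c : cocycles i d) : Coh i d :=
  Submodule.Quotient.mk c

/-- The classes of the cocycles lying in a subspace `S` of `C`. -/
def cohPart (i : C →ₗ[ℂ] A) (d : A →ₗ[ℂ] A) (S : Submodule ℂ C) : Submodule ℂ (Coh i d) :=
  (S.comap (cocycles i d).subtype).map (Submodule.mkQ _)

/-- The bilinear operation `μ` on cohomology is induced by the operation `op` on cochains: `op`
maps cocycles in `C` to cocycles in `C`, and the class of `op a b` is `μ [a] [b]`. -/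
def Induces (i : C →ₗ[ℂ] A) (d : A →ₗ[ℂ] A) (op : C →ₗ[ℂ] C →ₗ[ℂ] A)
    (μ : Coh i d →ₗ[ℂ] Coh i d →ₗ[ℂ] Coh i d) : Prop :=
  ∀ a b : cocycles i d, ∃ c : cocycles i d,
    i c = op a b ∧ μ (cls i d a) (cls i d b) = cls i d c

end Cohomology

/-! ### Graded associative algebras and graded Lie algebras -/

section Graded

variable {L L' : Type*} [AddCommGroup L] [Module ℂ L] [AddCommGroup L'] [Module ℂ L']

/-- `L = ⨁ n, G n` with the product `m` is a graded associative algebra (without unit). -/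
structure IsGradedAssoc (G : ℤ → Submodule ℂ L) (m : L →ₗ[ℂ] L →ₗ[ℂ] L) : Prop where
  internal : DirectSum.IsInternal G
  mul_mem : ∀ p q x y, x ∈ G p → y ∈ G q → m x y ∈ G (p + q)
  assoc : ∀ x y z, m (m x y) z = m x (m y z)

/-- `L = ⨁ n, G n` with the bracket `m` is a graded Lie algebra. -/
structure IsGradedLie (G : ℤ → Submodule ℂ L) (m : L →ₗ[ℂ] L →ₗ[ℂ] L) : Prop where
  internal : DirectSum.IsInternal G
  bracket_mem : ∀ p q x y, x ∈ G p → y ∈ G q → m x y ∈ G (p + q)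
  skew : ∀ p q x y, x ∈ G p → y ∈ G q → m x y = -((-1 : ℂ) ^ (p * q) • m y x)
  jacobi : ∀ p q x y z, x ∈ G p → y ∈ G q →
    m x (m y z) = m (m x y) z + (-1 : ℂ) ^ (p * q) • m y (m x z)

/-- `f` is an isomorphism of graded algebras, i.e. it is linear and bijective, it respects the
gradings (in degree `0`), and it is compatible with the products (or brackets). -/
structure IsGradedIso (G : ℤ → Submodule ℂ L) (m : L →ₗ[ℂ] L →ₗ[ℂ] L)
    (G' : ℤ → Submodule ℂ L') (m' : L' →ₗ[ℂ] L' →ₗ[ℂ] L') (f : L ≃ₗ[ℂ] L') : Prop where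
  map_deg : ∀ n, (G n).map f.toLinearMap = G' n
  map_op : ∀ x y, f (m x y) = m' (f x) (f y)

end Graded

/-! ### Quadratic Lie algebras and their cohomologies -/

section Lie

variable (g : Type*) [LieRing g] [LieAlgebra ℂ g]

/-- `g` with the bilinear form `B` is a quadratic Lie algebra. -/
structure IsQuadratic (B : LinearMap.BilinForm ℂ g) : Prop where
  symm : B.IsSymm
  nondegenerate : B.Nondegenerate
  invariant : ∀ X Y Z : g, B ⁅X, Y⁆ Z = -B Y ⁅X, Z⁆

/-- The Lie bracket `F₀ (X, Y) = [X, Y]` as a skew symmetric bilinear map. -/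
def lieMap : g [⋀^Fin 2]→ₗ[ℂ] g where
  toFun Y := ⁅Y 0, Y 1⁆
  map_update_add' Y i x y := by
    fin_cases i <;> simp [Function.update]
  map_update_smul' Y i c x := by
    fin_cases i <;> simp [Function.update]
  map_eq_zero_of_eq' Y i j h hij := by
    have h' : Y 0 = Y 1 := by
      fin_cases i <;> fin_cases j
      · exact absurd rfl hij
      · exact h
      · exact h.symm
      · exact absurd rfl hij
    rw [h', lie_self]

/-- The differential `d = ad F₀` of the adjoint cohomology complex. -/
def dAd : Alt g g →ₗ[ℂ] Alt g g := gerstenhaber (hom g g 2 (lieMap g))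

/-- The differential of the trivial cohomology complex, i.e. the derivation of the Grassmann algebra
associated with `F₀`: it maps `Ω` of degree `w` to minus the sum over all `(2,w-1)`-unshuffles `σ`
of `ε(σ) Ω ([Y_σ(1), Y_σ(2)], Y_σ(3), …, Y_σ(w+1))`. -/
def dTriv : Alt g ℂ →ₗ[ℂ] Alt g ℂ := -(insertion.flip (hom g g 2 (lieMap g)))

/-- The cohomology `H*(g)` with trivial coefficients. -/
abbrev HTriv : Type _ := Coh (LinearMap.id : Alt g ℂ →ₗ[ℂ] Alt g ℂ) (dTriv g)

/-- The degree `n` part of `H*(g)`. -/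
def HTrivDeg (n : ℤ) : Submodule ℂ (HTriv g) :=
  cohPart LinearMap.id (dTriv g) (degPart (fun k => g [⋀^Fin k]→ₗ[ℂ] ℂ) n)

/-- The reduced cohomology `H₊*(g)`, the sum of the `H^k(g)` with `k ≥ 1`. -/
def HPlus : Submodule ℂ (HTriv g) := ⨆ (n : ℤ) (_ : 1 ≤ n), HTrivDeg g n

/-- The degree `n` part of `H₊*(g)`. -/
def HPlusDeg (n : ℤ) : Submodule ℂ (HPlus g) :=
  if 1 ≤ n then (HTrivDeg g n).comap (HPlus g).subtype else ⊥

/-- `H_Q*(g) = H*(g) / ℂ`; here `ℂ = H⁰(g)` consists of the classes of the constants. -/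
abbrev HQuot : Type _ := HTriv g ⧸ HTrivDeg g 0

/-- The degree `n` part of `H_Q*(g)`. -/
def HQuotDeg (n : ℤ) : Submodule ℂ (HQuot g) := (HTrivDeg g n).map (HTrivDeg g 0).mkQ

variable {g} (B : LinearMap.BilinForm ℂ g)

/-- The cyclic cohomology `H_c*(g)`: the cohomology of the complex of cyclic cochains with
the differential `d = ad F₀`. -/
abbrev HCyc : Type _ := Coh (cycIncl B) (dAd g)

/-- The degree `n` part of `H_c*(g)`. -/
def HCycDeg (n : ℤ) : Submodule ℂ (HCyc B) :=
  cohPart (cycIncl B) (dAd g) (degPart (fun k => cyc B k) n)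

end Lie

end QuadraticLie

end

/-! Everything reduces to one observation: an element of `Alt V W` is determined by its contractions
`contr X` and its constant term `ev0` (`ext_contr`). Contractions are antiderivations of every
shuffle product (`contr_shuffleProd`) and of the Poisson bracket (`contr_poisson`). Hence the defect
of a bilinear or trilinear identity again obeys the antiderivation rule, and by induction on the
total degree it vanishes as soon as its constant term does (`bilin_eq_zero`, `trilin_eq_zero`).
Associativity, graded commutativity, graded skew symmetry and the graded Jacobi identity all follow
in this way. To make these identities multilinear, the signs depending on degrees are expressed
through the parity operator `sgn`.

The geometric input is `post_cycIncl`: skew symmetry of the form attached to a cyclic cochain C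
gives B(C, Z) = -2 `sgn` (ι_Z Φ(C)). Expanding an insertion in an orthonormal basis then turns F ∘
G, tested against Z, into a Poisson bracket of Φ(G) with a contraction of Φ(F). The two terms of the
Gerstenhaber bracket become the two terms of ι_Z applied to the Poisson bracket of Φ(F) and Φ(G)
(`gerstenhaber_cycIncl`). The same expansion gives ∂ = {Φ(F₀), ·} with Φ(F₀) an odd form
(`superPoisson_lieCyc`). So ∂ is a derivation of the wedge product, and by Jacobi of the bracket,
and Φ intertwines d with ∂. That ∂² = 0 comes from Cartan's formula and the Jacobi identity of the
Lie algebra.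

On cohomology only the constants need care. The values of ∂ have no constant term and ∂ kills
constants, so Φ identifies H_c both with H₊ and with H/ℂ. The wedge product preserves forms without
constant term, whereas the bracket of two 1-forms is a constant; this is why the bracket is compared
in H/ℂ. The structures on H_c are pulled back along these two bijections and then shown to be
induced by the operations on cochains. -/

open scoped DirectSum

noncomputable section

namespace QuadraticLie

section

/-! ### Shuffle products and their first argument -/

section Perm

open Equiv

/-- Every permutation of `Fin (n + 1)` is obtained by choosing the preimage of `0` and a permutation
of the remaining elements. -/
theorem sum_perm_succ {V W : Type*} [AddCommGroup W] {n : ℕ} (m : (Fin (n + 1) → V) → W) (X : V)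
    (w : Fin n → V) :
    ∑ σ : Perm (Fin (n + 1)), Perm.sign σ • m (Fin.cons X w ∘ σ) =
      ∑ j : Fin (n + 1), ∑ e : Perm (Fin n),
        ((-1 : ℤˣ) ^ (j : ℕ) * Perm.sign e) • m (Fin.insertNth j X (w ∘ e)) := by
  rw [← Fintype.sum_prod_type']
  -- `j.cycleRange` sends j to 0, has sign (-1)^j and keeps the order of the other indices; e then
  -- permutes these. Surjectivity comes from counting: (n + 1)! = (n + 1) · n!.
  let φ : Fin (n + 1) × Perm (Fin n) → Perm (Fin (n + 1)) := fun x =>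
    Perm.decomposeFin.symm (0, x.2) * x.1.cycleRange
  have h0 : ∀ x, φ x x.1 = 0 := fun x => by simp [φ]
  have hinj : Function.Injective φ := by
    rintro ⟨j, e⟩ ⟨j', e'⟩ h
    have h1 : j = j' := by
      apply (φ (j', e')).injective
      rw [h0 (j', e'), ← h, h0 (j, e)]
    subst h1
    have h2 : Perm.decomposeFin.symm (0, e) = Perm.decomposeFin.symm (0, e') :=
      mul_right_cancel h
    have h3 := Perm.decomposeFin.symm.injective h2
    simpa using h3
  have hbij : Function.Bijective φ := by
    rw [Fintype.bijective_iff_injective_and_card]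
    refine ⟨hinj, ?_⟩
    simp [Fintype.card_perm, Nat.factorial_succ]
  refine (Fintype.sum_bijective φ hbij _ _ ?_).symm
  rintro ⟨j, e⟩
  have hs : Perm.sign (φ (j, e)) = (-1 : ℤˣ) ^ (j : ℕ) * Perm.sign e := by
    simp [φ, Perm.decomposeFin.symm_sign, mul_comm]
  rw [hs]
  congr 2
  have : (Fin.cons X w : Fin (n + 1) → V) ∘ (Perm.decomposeFin.symm (0, e)) =
      Fin.cons X (w ∘ e) := by
    ext i
    refine Fin.cases ?_ (fun i => ?_) i
    · simp
    · simp
  simp only [φ, Perm.coe_mul, ← Function.comp_assoc]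
  rw [this, Fin.cons_comp_cycleRange]

end Perm

variable {V W W' W₁ W₂ W₃ : Type*} [AddCommGroup V] [Module ℂ V] [AddCommGroup W] [Module ℂ W]
  [AddCommGroup W'] [Module ℂ W'] [AddCommGroup W₁] [Module ℂ W₁] [AddCommGroup W₂] [Module ℂ W₂]
  [AddCommGroup W₃] [Module ℂ W₃]

section Shuffle

open Equiv

/-- The sum over all permutations defining the shuffle product up to a factor. -/
theorem factorial_smul_shuffle (μ : W₁ →ₗ[ℂ] W₂ →ₗ[ℂ] W₃) (p q : ℕ) (a : V [⋀^Fin p]→ₗ[ℂ] W₁)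
    (b : V [⋀^Fin q]→ₗ[ℂ] W₂) (v : Fin (p + q) → V) :
    (p.factorial * q.factorial) • shuffle μ p q a b v =
      ∑ σ : Perm (Fin (p + q)), Perm.sign σ •
        μ (a fun i => v (σ (Fin.castAdd q i))) (b fun i => v (σ (Fin.natAdd p i))) := by
  have h1 : shuffle μ p q a b v =
      TensorProduct.lift μ (a.domCoprod b (fun i => v (finSumFinEquiv i))) := rfl
  -- Each unshuffle class contains p! q! permutations, on all of which the summand is the same.
  -- Summing over the whole group avoids choosing representatives.
  have h2 := congrArg (fun f => f (fun i => v (finSumFinEquiv i)))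
    (MultilinearMap.domCoprod_alternization_eq a b)
  simp only [Fintype.card_fin, AlternatingMap.smul_apply] at h2
  rw [h1, ← map_nsmul, ← h2, MultilinearMap.alternatization_apply, map_sum]
  refine Fintype.sum_equiv (Equiv.permCongr finSumFinEquiv) _ _ fun σ => ?_
  rw [Perm.sign_permCongr]
  simp only [Units.smul_def]
  rw [map_zsmul]
  simp only [MultilinearMap.domDomCongr_apply, MultilinearMap.domCoprod_apply,
    TensorProduct.lift.tmul]
  simp

/-- The number of arguments is a variable n with a proof of p + q = n, since splitting off one
argument produces sums such as p + 1 + q that are not syntactically successors. -/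
theorem factorial_smul_shuffle_cast (μ : W₁ →ₗ[ℂ] W₂ →ₗ[ℂ] W₃) {p q n : ℕ} (h : p + q = n)
    (a : V [⋀^Fin p]→ₗ[ℂ] W₁) (b : V [⋀^Fin q]→ₗ[ℂ] W₂) (v : Fin n → V) :
    (p.factorial * q.factorial) • shuffle μ p q a b (fun i => v (Fin.cast h i)) =
      ∑ σ : Perm (Fin n), Perm.sign σ •
        μ (a fun i => v (σ (Fin.cast h (Fin.castAdd q i))))
          (b fun i => v (σ (Fin.cast h (Fin.natAdd p i)))) := by
  subst h
  exact factorial_smul_shuffle μ p q a b v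

/-- This and the next three lemmas compare positions: if X is inserted in one block of arguments,
that block sees X at the corresponding place and the other block does not notice it. -/
theorem insertNth_cast_castAdd {α : Type*} {p q n : ℕ} (h : p + 1 + q = n + 1) (h' : p + q = n)
    (j : Fin (p + 1)) (X : α) (u : Fin n → α) :
    (fun i => Fin.insertNth (α := fun _ => α) (Fin.cast h (Fin.castAdd q j)) X u
        (Fin.cast h (Fin.castAdd q i))) =
      Fin.insertNth j X (fun i => u (Fin.cast h' (Fin.castAdd q i))) := by
  rw [Fin.eq_insertNth_iff]
  constructor
  · simp
  · ext i
    simp only [Fin.removeNth]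
    have : Fin.cast h (Fin.castAdd q (j.succAbove i)) =
        (Fin.cast h (Fin.castAdd q j)).succAbove (Fin.cast h' (Fin.castAdd q i)) := by
      ext
      simp only [Fin.succAbove, Fin.lt_def]
      simp
      split_ifs <;> simp
    rw [this, Fin.insertNth_apply_succAbove]

theorem insertNth_cast_castAdd_natAdd {α : Type*} {p q n : ℕ} (h : p + 1 + q = n + 1)
    (h' : p + q = n) (j : Fin (p + 1)) (X : α) (u : Fin n → α) :
    (fun i => Fin.insertNth (α := fun _ => α) (Fin.cast h (Fin.castAdd q j)) X u
        (Fin.cast h (Fin.natAdd (p + 1) i))) =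
      (fun i => u (Fin.cast h' (Fin.natAdd p i))) := by
  ext i
  have : Fin.cast h (Fin.natAdd (p + 1) i) =
      (Fin.cast h (Fin.castAdd q j)).succAbove (Fin.cast h' (Fin.natAdd p i)) := by
    ext
    simp only [Fin.succAbove, Fin.lt_def]
    have := j.2
    simp
    split_ifs <;> simp <;> omega
  rw [this, Fin.insertNth_apply_succAbove]

theorem insertNth_cast_natAdd {α : Type*} {p q n : ℕ} (h : p + (q + 1) = n + 1) (h' : p + q = n)
    (j : Fin (q + 1)) (X : α) (u : Fin n → α) :
    (fun i => Fin.insertNth (α := fun _ => α) (Fin.cast h (Fin.natAdd p j)) X u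
        (Fin.cast h (Fin.natAdd p i))) =
      Fin.insertNth j X (fun i => u (Fin.cast h' (Fin.natAdd p i))) := by
  rw [Fin.eq_insertNth_iff]
  constructor
  · simp
  · ext i
    simp only [Fin.removeNth]
    have : Fin.cast h (Fin.natAdd p (j.succAbove i)) =
        (Fin.cast h (Fin.natAdd p j)).succAbove (Fin.cast h' (Fin.natAdd p i)) := by
      ext
      simp only [Fin.succAbove, Fin.lt_def]
      simp
      split_ifs <;> simp
      omega
    rw [this, Fin.insertNth_apply_succAbove]

theorem insertNth_cast_natAdd_castAdd {α : Type*} {p q n : ℕ} (h : p + (q + 1) = n + 1)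
    (h' : p + q = n) (j : Fin (q + 1)) (X : α) (u : Fin n → α) :
    (fun i => Fin.insertNth (α := fun _ => α) (Fin.cast h (Fin.natAdd p j)) X u
        (Fin.cast h (Fin.castAdd (q + 1) i))) =
      (fun i => u (Fin.cast h' (Fin.castAdd q i))) := by
  ext i
  have : Fin.cast h (Fin.castAdd (q + 1) i) =
      (Fin.cast h (Fin.natAdd p j)).succAbove (Fin.cast h' (Fin.castAdd q i)) := by
    ext
    simp only [Fin.succAbove, Fin.lt_def]
    have := i.2
    simp
    split_ifs <;> simp
    omega
  rw [this, Fin.insertNth_apply_succAbove]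

/-- The terms of the shuffle product with the first argument in the left factor. -/
theorem sum_insertNth_castAdd (μ : W₁ →ₗ[ℂ] W₂ →ₗ[ℂ] W₃) {p q n : ℕ} (h : p + 1 + q = n + 1)
    (h' : p + q = n) (a : V [⋀^Fin (p + 1)]→ₗ[ℂ] W₁) (b : V [⋀^Fin q]→ₗ[ℂ] W₂) (X : V)
    (w : Fin n → V) :
    ∑ j : Fin (p + 1), ∑ e : Perm (Fin n), ((-1 : ℤˣ) ^ (j : ℕ) * Perm.sign e) •
      μ (a fun i => Fin.insertNth (α := fun _ => V) (Fin.cast h (Fin.castAdd q j)) X (w ∘ e)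
          (Fin.cast h (Fin.castAdd q i)))
        (b fun i => Fin.insertNth (α := fun _ => V) (Fin.cast h (Fin.castAdd q j)) X (w ∘ e)
          (Fin.cast h (Fin.natAdd (p + 1) i))) =
      ((p + 1).factorial * q.factorial) •
        shuffle μ p q (a.curryLeft X) b (fun i => w (Fin.cast h' i)) := by
  simp only [insertNth_cast_castAdd h h', insertNth_cast_castAdd_natAdd h h',
    AlternatingMap.map_insertNth]
  rw [Nat.factorial_succ, mul_assoc, mul_smul, factorial_smul_shuffle_cast μ h']
  -- Moving X to the front of `a` costs (-1)^j, which cancels the sign of the permutation. The p + 1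
  -- positions contribute equally, and this turns p! into (p + 1)!.
  have : ∀ j : Fin (p + 1), (∑ e : Perm (Fin n), ((-1 : ℤˣ) ^ (j : ℕ) * Perm.sign e) •
      μ ((-1) ^ (j : ℕ) • a (Matrix.vecCons X fun i => (w ∘ e) (Fin.cast h' (Fin.castAdd q i))))
        (b fun i => (w ∘ e) (Fin.cast h' (Fin.natAdd p i)))) =
      ∑ e : Perm (Fin n), Perm.sign e •
        μ (a.curryLeft X fun i => w (e (Fin.cast h' (Fin.castAdd q i))))
          (b fun i => w (e (Fin.cast h' (Fin.natAdd p i)))) := by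
    intro j
    refine Finset.sum_congr rfl fun e _ => ?_
    simp only [Units.smul_def]
    rw [map_zsmul, LinearMap.smul_apply, smul_smul]
    congr 1
    push_cast
    rw [mul_right_comm, ← mul_pow]
    simp
  simp only [this]
  simp

/-- The terms of the shuffle product with the first argument in the right factor. -/
theorem sum_insertNth_natAdd (μ : W₁ →ₗ[ℂ] W₂ →ₗ[ℂ] W₃) {p q n : ℕ} (h : p + (q + 1) = n + 1)
    (h' : p + q = n) (a : V [⋀^Fin p]→ₗ[ℂ] W₁) (b : V [⋀^Fin (q + 1)]→ₗ[ℂ] W₂) (X : V)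
    (w : Fin n → V) :
    ∑ j : Fin (q + 1), ∑ e : Perm (Fin n), ((-1 : ℤˣ) ^ (p + j : ℕ) * Perm.sign e) •
      μ (a fun i => Fin.insertNth (α := fun _ => V) (Fin.cast h (Fin.natAdd p j)) X (w ∘ e)
          (Fin.cast h (Fin.castAdd (q + 1) i)))
        (b fun i => Fin.insertNth (α := fun _ => V) (Fin.cast h (Fin.natAdd p j)) X (w ∘ e)
          (Fin.cast h (Fin.natAdd p i))) =
      (p.factorial * (q + 1).factorial) •
        ((-1 : ℂ) ^ p • shuffle μ p q a (b.curryLeft X) (fun i => w (Fin.cast h' i))) := by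
  simp only [insertNth_cast_natAdd h h', insertNth_cast_natAdd_castAdd h h',
    AlternatingMap.map_insertNth]
  rw [smul_comm, Nat.factorial_succ, mul_left_comm, mul_smul,
    factorial_smul_shuffle_cast μ h']
  -- Now X sits at position p + j. Moving it to the front of `b` only undoes (-1)^j; the remaining
  -- (-1)^p is the sign of passing the arguments of `a`.
  have : ∀ j : Fin (q + 1), (∑ e : Perm (Fin n), ((-1 : ℤˣ) ^ (p + j : ℕ) * Perm.sign e) •
      μ (a fun i => (w ∘ e) (Fin.cast h' (Fin.castAdd q i)))
        ((-1) ^ (j : ℕ) • b (Matrix.vecCons X fun i => (w ∘ e) (Fin.cast h' (Fin.natAdd p i))))) =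
      (-1 : ℂ) ^ p • ∑ e : Perm (Fin n), Perm.sign e •
        μ (a fun i => w (e (Fin.cast h' (Fin.castAdd q i))))
          (b.curryLeft X fun i => w (e (Fin.cast h' (Fin.natAdd p i)))) := by
    intro j
    rw [Finset.smul_sum]
    refine Finset.sum_congr rfl fun e _ => ?_
    simp only [Units.smul_def]
    rw [map_zsmul, smul_smul, ← Int.cast_smul_eq_zsmul ℂ, ← Int.cast_smul_eq_zsmul ℂ, smul_smul]
    congr 1
    push_cast
    have : ((-1 : ℂ) ^ (j : ℕ)) * (-1) ^ (j : ℕ) = 1 := by rw [← mul_pow]; simp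
    rw [pow_add]
    linear_combination (-1 : ℂ) ^ p * ((Perm.sign e : ℤ) : ℂ) * this
  simp only [this]
  simp only [Finset.sum_const, Finset.card_univ, Fintype.card_fin]
  rw [smul_comm]

/-- The permutations are sorted by the place where X lands, and the places by the factor to which
they belong. -/
theorem shuffle_cons_sum (μ : W₁ →ₗ[ℂ] W₂ →ₗ[ℂ] W₃) {p q n : ℕ} (h : p + q = n + 1)
    (a : V [⋀^Fin p]→ₗ[ℂ] W₁) (b : V [⋀^Fin q]→ₗ[ℂ] W₂) (X : V) (w : Fin n → V) :
    (p.factorial * q.factorial) •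
        shuffle μ p q a b (fun i => (Fin.cons X w : Fin (n + 1) → V) (Fin.cast h i)) =
      (∑ j : Fin p, ∑ e : Perm (Fin n), ((-1 : ℤˣ) ^ (j : ℕ) * Perm.sign e) •
      μ (a fun i => Fin.insertNth (α := fun _ => V) (Fin.cast h (Fin.castAdd q j)) X (w ∘ e)
          (Fin.cast h (Fin.castAdd q i)))
        (b fun i => Fin.insertNth (α := fun _ => V) (Fin.cast h (Fin.castAdd q j)) X (w ∘ e)
          (Fin.cast h (Fin.natAdd p i)))) +
      ∑ j : Fin q, ∑ e : Perm (Fin n), ((-1 : ℤˣ) ^ (p + j : ℕ) * Perm.sign e) •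
      μ (a fun i => Fin.insertNth (α := fun _ => V) (Fin.cast h (Fin.natAdd p j)) X (w ∘ e)
          (Fin.cast h (Fin.castAdd q i)))
        (b fun i => Fin.insertNth (α := fun _ => V) (Fin.cast h (Fin.natAdd p j)) X (w ∘ e)
          (Fin.cast h (Fin.natAdd p i))) := by
  rw [factorial_smul_shuffle_cast μ h]
  have := sum_perm_succ (fun v : Fin (n + 1) → V =>
    μ (a fun i => v (Fin.cast h (Fin.castAdd q i))) (b fun i => v (Fin.cast h (Fin.natAdd p i)))) X w
  simp only [Function.comp_apply] at this
  rw [this, ← (finCongr h).sum_comp, Fin.sum_univ_add]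
  rfl

end Shuffle

/-! ### Contraction as an antiderivation -/

/-- Insertion of `X` as the first argument. -/
def contr (X : V) : Alt V W →ₗ[ℂ] Alt V W :=
  lift fun k => match k with
    | 0 => 0
    | k + 1 => hom V W k ∘ₗ AlternatingMap.curryLeftLinearMap.flip X

theorem contract_eq_contr (X : V) : (contract X : Alt V ℂ →ₗ[ℂ] Alt V ℂ) = contr X := by
  refine linearMap_ext fun k a => ?_
  cases k <;> simp [contract, contr]

@[simp]
theorem contr_hom_zero (X : V) (a : V [⋀^Fin 0]→ₗ[ℂ] W) : contr X (hom V W 0 a) = 0 := by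
  simp [contr]

@[simp]
theorem contr_hom_succ (X : V) (k : ℕ) (a : V [⋀^Fin (k + 1)]→ₗ[ℂ] W) :
    contr X (hom V W (k + 1) a) = hom V W k (a.curryLeft X) := by
  simp [contr]

/-- The operator multiplying a homogeneous element of degree `w` by `(-1)^w`. -/
def sgn : Alt V W →ₗ[ℂ] Alt V W :=
  lift fun w => (-1 : ℂ) ^ w • hom V W w

@[simp]
theorem sgn_hom (k : ℕ) (a : V [⋀^Fin k]→ₗ[ℂ] W) :
    sgn (hom V W k a) = (-1 : ℂ) ^ k • hom V W k a := by
  simp [sgn]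

theorem shuffleProd_hom (μ : W₁ →ₗ[ℂ] W₂ →ₗ[ℂ] W₃) (p q : ℕ) (a : V [⋀^Fin p]→ₗ[ℂ] W₁)
    (b : V [⋀^Fin q]→ₗ[ℂ] W₂) :
    shuffleProd μ (hom V W₁ p a) (hom V W₂ q b) = hom V W₃ (p + q) (shuffle μ p q a b) := by
  simp [shuffleProd, bilinExt_hom]

theorem hom_cast {m n : ℕ} (h : m = n) (a : V [⋀^Fin m]→ₗ[ℂ] W) :
    hom V W m a = hom V W n (a.domDomCongr (finCongr h)) := by
  subst h
  rfl

/-- Contraction is an antiderivation of the shuffle products. -/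
theorem contr_shuffleProd_hom (μ : W₁ →ₗ[ℂ] W₂ →ₗ[ℂ] W₃) (p q : ℕ) (a : V [⋀^Fin p]→ₗ[ℂ] W₁)
    (b : V [⋀^Fin q]→ₗ[ℂ] W₂) (X : V) :
    contr X (shuffleProd μ (hom V W₁ p a) (hom V W₂ q b)) =
      shuffleProd μ (contr X (hom V W₁ p a)) (hom V W₂ q b) +
        (-1 : ℂ) ^ p • shuffleProd μ (hom V W₁ p a) (contr X (hom V W₂ q b)) := by
  have cancel : ∀ (x y : W₃), (p.factorial * q.factorial) • x = (p.factorial * q.factorial) • y →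
      x = y := by
    intro x y h
    rw [← Nat.cast_smul_eq_nsmul ℂ, ← Nat.cast_smul_eq_nsmul ℂ] at h
    exact smul_right_injective _
      (Nat.cast_ne_zero.mpr (mul_ne_zero p.factorial_ne_zero q.factorial_ne_zero)) h
  rw [shuffleProd_hom]
  -- A factor of degree 0 has no place for X and its contraction is 0, so only the terms of the
  -- other factor survive.
  rcases p with _ | p <;> rcases q with _ | q
  · simp
  · rw [hom_cast (Nat.zero_add (q + 1)), contr_hom_succ, contr_hom_succ, contr_hom_zero,
      shuffleProd_hom, map_zero, LinearMap.zero_apply, zero_add (_ : Alt V W₃),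
      hom_cast (Nat.zero_add q) (shuffle μ 0 q a (b.curryLeft X)), ← map_smul]
    congr 1
    ext w
    apply cancel
    change _ • shuffle μ 0 (q + 1) a b (fun i => (Fin.cons X w : Fin (q + 1) → V)
      (Fin.cast (Nat.zero_add (q + 1)) i)) = _
    rw [shuffle_cons_sum μ (Nat.zero_add (q + 1)),
      sum_insertNth_natAdd μ (Nat.zero_add (q + 1)) (Nat.zero_add q)]
    simp
    rfl
  · rw [contr_hom_succ, contr_hom_succ, contr_hom_zero,
      shuffleProd_hom, map_zero, smul_zero, add_zero (_ : Alt V W₃)]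
    congr 1
    ext w
    apply cancel
    change _ • shuffle μ (p + 1) 0 a b (fun i => (Fin.cons X w : Fin (p + 1) → V)
      (Fin.cast (Nat.add_zero (p + 1)) i)) = _
    rw [shuffle_cons_sum μ (Nat.add_zero (p + 1)),
      sum_insertNth_castAdd μ (Nat.add_zero (p + 1)) (Nat.add_zero p)]
    simp
  · have e : p + 1 + (q + 1) = (p + q + 1) + 1 := by omega
    have e1 : p + (q + 1) = p + q + 1 := by omega
    have e2 : p + 1 + q = p + q + 1 := by omega
    rw [hom_cast e, contr_hom_succ, contr_hom_succ, contr_hom_succ,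
      shuffleProd_hom, shuffleProd_hom, hom_cast e1, hom_cast e2, ← map_smul, ← map_add]
    congr 1
    ext w
    apply cancel
    change _ • shuffle μ (p + 1) (q + 1) a b (fun i => (Fin.cons X w : Fin (p + q + 1 + 1) → V)
      (Fin.cast e i)) = _
    rw [shuffle_cons_sum μ e, sum_insertNth_castAdd μ e e1, sum_insertNth_natAdd μ e e2, ← smul_add]
    rfl

/-- Two bilinear maps agree if they agree on homogeneous elements. -/
theorem bilin_ext {M N : ℕ → Type*} [∀ k, AddCommGroup (M k)] [∀ k, Module ℂ (M k)]
    [∀ k, AddCommGroup (N k)] [∀ k, Module ℂ (N k)] {X : Type*} [AddCommGroup X] [Module ℂ X]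
    {f f' : GrSum M →ₗ[ℂ] GrSum N →ₗ[ℂ] X}
    (h : ∀ p q (a : M p) (b : N q), f (incl M p a) (incl N q b) = f' (incl M p a) (incl N q b)) :
    f = f' :=
  linearMap_ext fun p a => linearMap_ext fun q b => h p q a b

/-- Writing the sign (-1)^p as the operator `sgn` makes the rule bilinear, hence valid for
inhomogeneous elements; this is the form required by `bilin_eq_zero` and `trilin_eq_zero`. -/
theorem contr_shuffleProd (μ : W₁ →ₗ[ℂ] W₂ →ₗ[ℂ] W₃) (a : Alt V W₁) (b : Alt V W₂) (X : V) :
    contr X (shuffleProd μ a b) =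
      shuffleProd μ (contr X a) b + shuffleProd μ (sgn a) (contr X b) := by
  have : (shuffleProd μ).compr₂ (contr X) = (shuffleProd μ).compl₁₂ (contr X) LinearMap.id +
      (shuffleProd (V := V) μ).compl₁₂ sgn (contr X) := by
    refine bilin_ext fun p q a b => ?_
    have := contr_shuffleProd_hom μ p q a b X
    simpa using this
  exact LinearMap.congr_fun (LinearMap.congr_fun this a) b

end

section

variable {V W W' W₁ W₂ W₃ W₁' W₂' : Type*} [AddCommGroup V] [Module ℂ V] [AddCommGroup W]
  [Module ℂ W] [AddCommGroup W'] [Module ℂ W'] [AddCommGroup W₁] [Module ℂ W₁] [AddCommGroup W₂]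
  [Module ℂ W₂] [AddCommGroup W₃] [Module ℂ W₃] [AddCommGroup W₁'] [Module ℂ W₁']
  [AddCommGroup W₂'] [Module ℂ W₂']

/-! ### Elements determined by their contractions -/

/-- The value of the component of degree `0`. -/
def ev0 : Alt V W →ₗ[ℂ] W :=
  lift fun k => match k with
    | 0 => { toFun := fun a => a Fin.elim0, map_add' := fun _ _ => rfl, map_smul' := fun _ _ => rfl }
    | _ + 1 => 0

@[simp]
theorem ev0_hom_zero (a : V [⋀^Fin 0]→ₗ[ℂ] W) : ev0 (hom V W 0 a) = a Fin.elim0 := by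
  simp [ev0]

@[simp]
theorem ev0_hom_succ (k : ℕ) (a : V [⋀^Fin (k + 1)]→ₗ[ℂ] W) : ev0 (hom V W (k + 1) a) = 0 := by
  simp [ev0]

theorem coord_zero_eq (a : Alt V W) (v : Fin 0 → V) :
    coord (fun k : ℕ => V [⋀^Fin k]→ₗ[ℂ] W) 0 a v = ev0 a := by
  have : ({ toFun := fun a => a v, map_add' := fun _ _ => rfl, map_smul' := fun _ _ => rfl } :
      (V [⋀^Fin 0]→ₗ[ℂ] W) →ₗ[ℂ] W) ∘ₗ coord (fun k : ℕ => V [⋀^Fin k]→ₗ[ℂ] W) 0 = ev0 := by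
    refine linearMap_ext fun k a => ?_
    cases k with
    | zero =>
      rw [ev0_hom_zero, LinearMap.comp_apply, coord_incl_self]
      exact congrArg a (Subsingleton.elim _ _)
    | succ k =>
      rw [ev0_hom_succ, LinearMap.comp_apply, coord_incl_ne (Nat.succ_ne_zero k), map_zero]
  exact LinearMap.congr_fun this a

theorem coord_contr (X : V) (k : ℕ) (a : Alt V W) (v : Fin k → V) :
    coord (fun k : ℕ => V [⋀^Fin k]→ₗ[ℂ] W) k (contr X a) v =
      coord (fun k : ℕ => V [⋀^Fin k]→ₗ[ℂ] W) (k + 1) a (Fin.cons X v) := by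
  have : coord (fun k : ℕ => V [⋀^Fin k]→ₗ[ℂ] W) k ∘ₗ contr X =
      AlternatingMap.curryLeftLinearMap.flip X ∘ₗ
        coord (fun k : ℕ => V [⋀^Fin k]→ₗ[ℂ] W) (k + 1) := by
    refine linearMap_ext fun j a => ?_
    simp only [LinearMap.comp_apply]
    cases j with
    | zero => rw [contr_hom_zero, coord_incl_ne (Nat.succ_ne_zero k).symm, map_zero, map_zero]
    | succ j =>
      rw [contr_hom_succ]
      by_cases h : j = k
      · subst h
        rw [coord_incl_self, coord_incl_self]
        rfl
      · rw [coord_incl_ne h, coord_incl_ne (fun h' => h (Nat.succ_injective h')), map_zero]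
  exact DFunLike.congr_fun (LinearMap.congr_fun this a) v

theorem grSum_ext {M : ℕ → Type*} [∀ k, AddCommGroup (M k)] [∀ k, Module ℂ (M k)] {a b : GrSum M}
    (h : ∀ k, coord M k a = coord M k b) : a = b :=
  DFinsupp.ext h

/-- An element is determined by its contractions and by its component of degree `0`. -/
theorem ext_contr {a b : Alt V W} (h : ∀ X, contr X a = contr X b) (h0 : ev0 a = ev0 b) :
    a = b := by
  refine grSum_ext fun k => AlternatingMap.ext fun v => ?_
  cases k with
  | zero => rw [coord_zero_eq, coord_zero_eq, h0]
  | succ k => rw [← Fin.cons_self_tail v, ← coord_contr, ← coord_contr, h]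

theorem eq_zero_of_contr {a : Alt V W} (h : ∀ X, contr X a = 0) (h0 : ev0 a = 0) : a = 0 :=
  ext_contr (fun X => by rw [h X, map_zero]) (by rw [h0, map_zero])

/-- A linear map which commutes or anticommutes with all contractions and has values without
component of degree `0` vanishes. -/
theorem lin_eq_zero {S : Alt V W →ₗ[ℂ] Alt V W'} (s : ℂ)
    (hS : ∀ X a, contr X (S a) = s • S (contr X a)) (h0 : ∀ a, ev0 (S a) = 0) : S = 0 := by
  refine linearMap_ext fun k => ?_
  induction k with
  | zero => exact fun a => eq_zero_of_contr (fun X => by simp [hS]) (h0 _)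
  | succ k ih =>
    refine fun a => eq_zero_of_contr (fun X => ?_) (h0 _)
    rw [hS, contr_hom_succ, ih]
    simp

/-- A bilinear map for which contractions are antiderivations and which has values without
component of degree `0` vanishes. -/
theorem bilin_eq_zero {T : Alt V W₁ →ₗ[ℂ] Alt V W₂ →ₗ[ℂ] Alt V W}
    (hT : ∀ X a b, contr X (T a b) = T (contr X a) b + T (sgn a) (contr X b))
    (h0 : ∀ a b, ev0 (T a b) = 0) (a : Alt V W₁) (b : Alt V W₂) : T a b = 0 := by
  -- Each term of the antiderivation rule lowers one of the two degrees, so induction on the total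
  -- degree makes all contractions vanish.
  suffices H : ∀ n p q, p + q = n → ∀ a b, T (hom V W₁ p a) (hom V W₂ q b) = 0 by
    have : T = 0 := bilin_ext fun p q a b => by simpa using H _ p q rfl a b
    simp [this]
  intro n
  induction n using Nat.strong_induction_on with
  | _ n ih =>
    intro p q hpq a b
    refine eq_zero_of_contr (fun X => ?_) (h0 _ _)
    have h1 : T (contr X (hom V W₁ p a)) (hom V W₂ q b) = 0 := by
      cases p with
      | zero => simp
      | succ p => rw [contr_hom_succ]; exact ih (p + q) (by omega) p q rfl _ _
    have h2 : T (hom V W₁ p a) (contr X (hom V W₂ q b)) = 0 := by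
      cases q with
      | zero => simp
      | succ q => rw [contr_hom_succ]; exact ih (p + q) (by omega) p q rfl _ _
    rw [hT, h1, sgn_hom, map_smul, LinearMap.smul_apply, h2, smul_zero, add_zero]

/-- A trilinear map for which contractions are antiderivations and which has values without
component of degree `0` vanishes. -/
theorem trilin_eq_zero {T : Alt V W₁ →ₗ[ℂ] Alt V W₂ →ₗ[ℂ] Alt V W₃ →ₗ[ℂ] Alt V W}
    (hT : ∀ X a b c, contr X (T a b c) =
      T (contr X a) b c + T (sgn a) (contr X b) c + T (sgn a) (sgn b) (contr X c))
    (h0 : ∀ a b c, ev0 (T a b c) = 0) (a : Alt V W₁) (b : Alt V W₂) (c : Alt V W₃) :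
    T a b c = 0 := by
  suffices H : ∀ n p q r, p + q + r = n → ∀ a b c,
      T (hom V W₁ p a) (hom V W₂ q b) (hom V W₃ r c) = 0 by
    have : T = 0 := bilin_ext fun p q a b => linearMap_ext fun r c => by
      simpa using H _ p q r rfl a b c
    simp [this]
  intro n
  induction n using Nat.strong_induction_on with
  | _ n ih =>
    intro p q r hpq a b c
    refine eq_zero_of_contr (fun X => ?_) (h0 _ _ _)
    have h1 : T (contr X (hom V W₁ p a)) (hom V W₂ q b) (hom V W₃ r c) = 0 := by
      cases p with
      | zero => simp
      | succ p => rw [contr_hom_succ]; exact ih (p + q + r) (by omega) p q r rfl _ _ _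
    have h2 : T (hom V W₁ p a) (contr X (hom V W₂ q b)) (hom V W₃ r c) = 0 := by
      cases q with
      | zero => simp
      | succ q => rw [contr_hom_succ]; exact ih (p + q + r) (by omega) p q r rfl _ _ _
    have h3 : T (hom V W₁ p a) (hom V W₂ q b) (contr X (hom V W₃ r c)) = 0 := by
      cases r with
      | zero => simp
      | succ r => rw [contr_hom_succ]; exact ih (p + q + r) (by omega) p q r rfl _ _ _
    rw [hT, h1, sgn_hom, sgn_hom]
    simp only [map_smul, LinearMap.smul_apply, h2, h3, smul_zero, add_zero]

/-! ### Calculus of contractions, signs and products -/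

theorem contr_add (X Y : V) (a : Alt V W) : contr (X + Y) a = contr X a + contr Y a := by
  have : contr (W := W) (X + Y) = contr X + contr Y := by
    refine linearMap_ext fun k a => ?_
    cases k <;> simp
  simp [this]

theorem contr_contr (X Y : V) (a : Alt V W) : contr X (contr Y a) = -contr Y (contr X a) := by
  have : contr (W := W) X ∘ₗ contr Y = -(contr Y ∘ₗ contr X) := by
    refine linearMap_ext fun k a => ?_
    simp only [LinearMap.comp_apply, LinearMap.neg_apply]
    rcases k with _ | _ | k
    · simp
    · simp
    · simp only [contr_hom_succ]
      rw [← map_neg]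
      congr 1
      ext v
      have h := a.map_swap (Matrix.vecCons X (Matrix.vecCons Y v)) (i := 0) (j := 1) (by simp)
      have e : (Matrix.vecCons X (Matrix.vecCons Y v)) ∘ (Equiv.swap (0 : Fin (k + 2)) 1) =
          Matrix.vecCons Y (Matrix.vecCons X v) := by
        ext i
        refine Fin.cases ?_ (fun i => Fin.cases ?_ (fun i => ?_) i) i
        · simp
        · simp
        · rw [Function.comp_apply, Equiv.swap_apply_of_ne_of_ne]
          · simp
          · exact Fin.succ_ne_zero _
          · intro h
            have := Fin.succ_injective _ (h.trans Fin.succ_zero_eq_one.symm)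
            exact Fin.succ_ne_zero _ this
      rw [e] at h
      simp only [AlternatingMap.curryLeft_apply_apply, AlternatingMap.neg_apply]
      rw [h]
  exact LinearMap.congr_fun this a

theorem contr_sgn (X : V) (a : Alt V W) : contr X (sgn a) = -sgn (contr X a) := by
  have : contr (W := W) X ∘ₗ sgn = -(sgn ∘ₗ contr X) := by
    refine linearMap_ext fun k a => ?_
    cases k with
    | zero => simp
    | succ k => simp [pow_succ]
  exact LinearMap.congr_fun this a

@[simp]
theorem sgn_sgn (a : Alt V W) : sgn (sgn a) = a := by
  have : sgn ∘ₗ sgn = (LinearMap.id : Alt V W →ₗ[ℂ] Alt V W) := by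
    refine linearMap_ext fun k a => ?_
    simp only [LinearMap.comp_apply, sgn_hom, map_smul, smul_smul, ← mul_pow]
    simp
  exact LinearMap.congr_fun this a

@[simp]
theorem ev0_sgn (a : Alt V W) : ev0 (sgn a) = ev0 a := by
  have : ev0 ∘ₗ sgn = (ev0 : Alt V W →ₗ[ℂ] W) := by
    refine linearMap_ext fun k a => ?_
    cases k <;> simp
  exact LinearMap.congr_fun this a

theorem sgn_shuffleProd (μ : W₁ →ₗ[ℂ] W₂ →ₗ[ℂ] W₃) (a : Alt V W₁) (b : Alt V W₂) :
    sgn (shuffleProd μ a b) = shuffleProd μ (sgn a) (sgn b) := by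
  have : (shuffleProd (V := V) μ).compr₂ sgn = (shuffleProd μ).compl₁₂ sgn sgn := by
    refine bilin_ext fun p q a b => ?_
    have := sgn_hom (p + q) (shuffle μ p q a b)
    simp [shuffleProd_hom, smul_smul, pow_add, mul_comm]
  exact LinearMap.congr_fun (LinearMap.congr_fun this a) b

theorem shuffle_zero_zero (μ : W₁ →ₗ[ℂ] W₂ →ₗ[ℂ] W₃) (a : V [⋀^Fin 0]→ₗ[ℂ] W₁)
    (b : V [⋀^Fin 0]→ₗ[ℂ] W₂) (v : Fin 0 → V) : shuffle μ 0 0 a b v = μ (a v) (b v) := by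
  have := factorial_smul_shuffle μ 0 0 a b v
  simp only [Nat.factorial_zero, mul_one, one_smul] at this
  rw [this, Fintype.sum_eq_single (1 : Equiv.Perm (Fin (0 + 0)))
    fun σ h => absurd (Equiv.ext fun i => i.elim0) h, Equiv.Perm.sign_one, one_smul]
  exact congrArg₂ (fun x y : Fin 0 → V => μ (a x) (b y)) (Subsingleton.elim _ _)
    (Subsingleton.elim _ _)

@[simp]
theorem ev0_shuffleProd (μ : W₁ →ₗ[ℂ] W₂ →ₗ[ℂ] W₃) (a : Alt V W₁) (b : Alt V W₂) :
    ev0 (shuffleProd μ a b) = μ (ev0 a) (ev0 b) := by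
  have : (shuffleProd (V := V) μ).compr₂ ev0 = μ.compl₁₂ ev0 ev0 := by
    refine bilin_ext fun p q a b => ?_
    simp only [LinearMap.compr₂_apply, LinearMap.compl₁₂_apply, shuffleProd_hom]
    rcases p with _ | p
    · rcases q with _ | q
      · simp [shuffle_zero_zero]
      · rw [ev0_hom_succ, map_zero]
        exact ev0_hom_succ (0 + q) _
    · rw [hom_cast (show p + 1 + q = p + q + 1 by omega), ev0_hom_succ, ev0_hom_succ, map_zero,
        LinearMap.zero_apply]
  exact LinearMap.congr_fun (LinearMap.congr_fun this a) b

/-- Composition of skew symmetric maps with a linear map on the values. -/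
def post (f : W →ₗ[ℂ] W') : Alt V W →ₗ[ℂ] Alt V W' :=
  lift fun k => hom V W' k ∘ₗ LinearMap.compAlternatingMapₗ ℂ f

@[simp]
theorem post_hom (f : W →ₗ[ℂ] W') (k : ℕ) (a : V [⋀^Fin k]→ₗ[ℂ] W) :
    post f (hom V W k a) = hom V W' k (f.compAlternatingMap a) := by
  simp [post]

theorem contr_post (f : W →ₗ[ℂ] W') (X : V) (a : Alt V W) :
    contr X (post f a) = post f (contr X a) := by
  have : contr X ∘ₗ post f = post f ∘ₗ contr (V := V) X := by
    refine linearMap_ext fun k a => ?_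
    cases k <;> simp
  exact LinearMap.congr_fun this a

theorem sgn_post (f : W →ₗ[ℂ] W') (a : Alt V W) : sgn (post f a) = post f (sgn a) := by
  have : sgn ∘ₗ post f = post f ∘ₗ sgn (V := V) := by
    refine linearMap_ext fun k a => ?_
    simp
  exact LinearMap.congr_fun this a

@[simp]
theorem ev0_post (f : W →ₗ[ℂ] W') (a : Alt V W) : ev0 (post f a) = f (ev0 a) := by
  have : ev0 ∘ₗ post f = f ∘ₗ ev0 (V := V) := by
    refine linearMap_ext fun k a => ?_
    cases k <;> simp
  exact LinearMap.congr_fun this a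

/-- Shuffle products along bilinear maps related by linear maps are related. -/
theorem shuffleProd_post (μ : W₁' →ₗ[ℂ] W₂' →ₗ[ℂ] W₃) (f : W₁ →ₗ[ℂ] W₁') (g : W₂ →ₗ[ℂ] W₂')
    (a : Alt V W₁) (b : Alt V W₂) :
    shuffleProd μ (post f a) (post g b) = shuffleProd (μ.compl₁₂ f g) a b := by
  refine sub_eq_zero.mp (bilin_eq_zero (T := (shuffleProd (V := V) μ).compl₁₂ (post f) (post g) -
    shuffleProd (μ.compl₁₂ f g)) (fun X a b => ?_) (fun a b => ?_) a b)
  · simp only [LinearMap.sub_apply, LinearMap.compl₁₂_apply, map_sub, contr_shuffleProd, contr_post,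
      sgn_post]
    abel
  · simp

theorem post_shuffleProd (μ : W₁ →ₗ[ℂ] W₂ →ₗ[ℂ] W₃) (f : W₃ →ₗ[ℂ] W)
    (a : Alt V W₁) (b : Alt V W₂) :
    post f (shuffleProd μ a b) = shuffleProd (μ.compr₂ f) a b := by
  refine sub_eq_zero.mp (bilin_eq_zero (T := (shuffleProd (V := V) μ).compr₂ (post f) -
    shuffleProd (μ.compr₂ f)) (fun X a b => ?_) (fun a b => ?_) a b)
  · simp only [LinearMap.sub_apply, LinearMap.compr₂_apply, map_sub, contr_shuffleProd, contr_post]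
    rw [map_add]
    abel
  · simp

/-- Used to expand an evaluation over a basis, one rank-one bilinear map for each basis vector. -/
theorem shuffleProd_sum {ι : Type*} (s : Finset ι) (μ : ι → W₁ →ₗ[ℂ] W₂ →ₗ[ℂ] W₃) (a : Alt V W₁)
    (b : Alt V W₂) : shuffleProd (∑ i ∈ s, μ i) a b = ∑ i ∈ s, shuffleProd (μ i) a b := by
  refine sub_eq_zero.mp ((bilin_eq_zero (T := shuffleProd (V := V) (∑ i ∈ s, μ i) -
    ∑ i ∈ s, shuffleProd (μ i)) (fun X a b => ?_) (fun a b => ?_) a b).symm.trans ?_).symm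
  · simp only [LinearMap.sub_apply, LinearMap.sum_apply, map_sub, map_sum, contr_shuffleProd,
      Finset.sum_add_distrib]
    abel
  · simp
  · simp

/-! ### The wedge product -/

theorem contr_wedge (X : V) (a b : Alt V ℂ) :
    contr X (wedge a b) = wedge (contr X a) b + wedge (sgn a) (contr X b) :=
  contr_shuffleProd _ a b X

theorem sgn_wedge (a b : Alt V ℂ) : sgn (wedge a b) = wedge (sgn a) (sgn b) :=
  sgn_shuffleProd _ a b

@[simp]
theorem ev0_wedge (a b : Alt V ℂ) : ev0 (wedge a b) = ev0 a * ev0 b := by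
  simp [wedge]

/-- The trilinear map `(a, b, c) ↦ f (h a b) c`. -/
def compLeft (f h : Alt V W →ₗ[ℂ] Alt V W →ₗ[ℂ] Alt V W) :
    Alt V W →ₗ[ℂ] Alt V W →ₗ[ℂ] Alt V W →ₗ[ℂ] Alt V W :=
  h.compr₂ f

/-- The trilinear map `(a, b, c) ↦ f a (h b c)`. -/
def compRight (f h : Alt V W →ₗ[ℂ] Alt V W →ₗ[ℂ] Alt V W) :
    Alt V W →ₗ[ℂ] Alt V W →ₗ[ℂ] Alt V W →ₗ[ℂ] Alt V W :=
  (LinearMap.llcomp ℂ (Alt V W) (Alt V W) (Alt V W) ∘ₗ f).compl₂ h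

@[simp]
theorem compLeft_apply (f h : Alt V W →ₗ[ℂ] Alt V W →ₗ[ℂ] Alt V W) (a b c : Alt V W) :
    compLeft f h a b c = f (h a b) c := rfl

@[simp]
theorem compRight_apply (f h : Alt V W →ₗ[ℂ] Alt V W →ₗ[ℂ] Alt V W) (a b c : Alt V W) :
    compRight f h a b c = f a (h b c) := rfl

/-- The associator obeys the trilinear antiderivation rule, and its constant term is the associator
of ℂ. -/
theorem wedge_assoc (a b c : Alt V ℂ) : wedge (wedge a b) c = wedge a (wedge b c) := by
  refine sub_eq_zero.mp (trilin_eq_zero (T := compLeft wedge wedge - compRight wedge wedge)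
    (fun X a b c => ?_) (fun a b c => ?_) a b c)
  · simp only [LinearMap.sub_apply, compLeft_apply, compRight_apply, map_sub, map_add, contr_wedge,
      sgn_wedge, LinearMap.add_apply]
    abel
  · simp [mul_assoc]

/-- Graded commutativity, in a form valid for elements which need not be homogeneous. -/
theorem wedge_comm (a b : Alt V ℂ) :
    wedge a b = (1 / 2 : ℂ) •
      (wedge b a + wedge b (sgn a) + wedge (sgn b) a - wedge (sgn b) (sgn a)) := by
  -- On elements of degrees p and q, half of 1 + (-1)^p + (-1)^q - (-1)^(p+q) equals (-1)^(pq): it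
  -- is -1 if both degrees are odd and 1 otherwise. So this combination of parity operators encodes
  -- the Koszul sign.
  refine sub_eq_zero.mp (bilin_eq_zero (T := wedge - (1 / 2 : ℂ) • (wedge.flip +
    wedge.flip.compl₁₂ sgn LinearMap.id + wedge.flip.compl₁₂ LinearMap.id sgn -
    wedge.flip.compl₁₂ sgn sgn)) (fun X a b => ?_) (fun a b => ?_) a b)
  · simp only [LinearMap.sub_apply, LinearMap.add_apply, LinearMap.smul_apply, LinearMap.flip_apply,
      LinearMap.compl₁₂_apply, LinearMap.id_apply, map_sub, map_add, map_smul, contr_wedge,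
      contr_sgn, sgn_sgn, map_neg, LinearMap.neg_apply]
    module
  · simp
    ring

end

/-! ### The Poisson bracket of a family of vectors -/

section Poisson

variable {V : Type*} [AddCommGroup V] [Module ℂ V] {ι : Type*} [Fintype ι]

/-- The bracket `(-1)^(w+1) ∑ j, ι_{e_j} Ω ∧ ι_{e_j} Ω'` of a finite family of vectors. -/
def poisson (e : ι → V) : Alt V ℂ →ₗ[ℂ] Alt V ℂ →ₗ[ℂ] Alt V ℂ :=
  ∑ j, wedge.compl₁₂ (sgn ∘ₗ contr (e j)) (contr (e j))

theorem poisson_apply (e : ι → V) (a b : Alt V ℂ) :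
    poisson e a b = ∑ j, wedge (sgn (contr (e j) a)) (contr (e j) b) := by
  simp [poisson]

/-- The contraction by X anticommutes with ι_{e_j} and with `sgn`, so the signs cancel in pairs. The
bracket therefore obeys the same rule as the wedge product, and its identities are again decided by
constant terms. -/
theorem contr_poisson (e : ι → V) (X : V) (a b : Alt V ℂ) :
    contr X (poisson e a b) = poisson e (contr X a) b + poisson e (sgn a) (contr X b) := by
  simp only [poisson_apply, map_sum, ← Finset.sum_add_distrib]
  refine Finset.sum_congr rfl fun j _ => ?_
  rw [contr_wedge, contr_sgn, sgn_sgn, contr_sgn, contr_contr X (e j) a, contr_contr X (e j) b]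
  simp

theorem sgn_poisson (e : ι → V) (a b : Alt V ℂ) :
    sgn (poisson e a b) = poisson e (sgn a) (sgn b) := by
  simp only [poisson_apply, map_sum, sgn_wedge, contr_sgn, map_neg, LinearMap.neg_apply, neg_neg]

theorem ev0_poisson (e : ι → V) (a b : Alt V ℂ) :
    ev0 (poisson e a b) = ∑ j, ev0 (contr (e j) a) * ev0 (contr (e j) b) := by
  simp [poisson_apply]

/-- Graded skew symmetry, for elements which need not be homogeneous. -/
theorem poisson_skew (e : ι → V) (a b : Alt V ℂ) :
    poisson e a b = -((1 / 2 : ℂ) • (poisson e b a + poisson e b (sgn a) +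
      poisson e (sgn b) a - poisson e (sgn b) (sgn a))) := by
  refine eq_neg_of_add_eq_zero_left (bilin_eq_zero (T := poisson e + (1 / 2 : ℂ) •
    ((poisson e).flip + (poisson e).flip.compl₁₂ sgn LinearMap.id +
      (poisson e).flip.compl₁₂ LinearMap.id sgn -
      (poisson e).flip.compl₁₂ sgn sgn)) (fun X a b => ?_) (fun a b => ?_) a b)
  · simp only [LinearMap.sub_apply, LinearMap.add_apply, LinearMap.smul_apply, LinearMap.flip_apply,
      LinearMap.compl₁₂_apply, LinearMap.id_apply, map_sub, map_add, map_smul, contr_poisson,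
      contr_sgn, sgn_sgn, map_neg, LinearMap.neg_apply]
    module
  · simp only [LinearMap.sub_apply, LinearMap.add_apply, LinearMap.smul_apply, LinearMap.flip_apply,
      LinearMap.compl₁₂_apply, LinearMap.id_apply, map_sub, map_add, map_smul, ev0_poisson,
      contr_sgn, map_neg, ev0_sgn, smul_eq_mul, Finset.mul_sum, ← Finset.sum_add_distrib,
      ← Finset.sum_sub_distrib]
    -- Constant terms involve only the 1-form parts. There both parity signs are -1, so the Koszul
    -- combination is -1 and the symmetric sum cancels against itself.
    exact Finset.sum_eq_zero fun j _ => by ring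

/-- The scalar `∑ j k, a(e_j) b(e_j, e_k) c(e_k)`. -/
def path (e : ι → V) (a b c : Alt V ℂ) : ℂ :=
  ∑ j, ∑ k, ev0 (contr (e j) a) * ev0 (contr (e k) (contr (e j) b)) * ev0 (contr (e k) c)

/-- The middle form is skew symmetric, so reversing the path changes its sign. -/
theorem path_swap (e : ι → V) (a b c : Alt V ℂ) : path e a b c = -path e c b a := by
  rw [path, path, Finset.sum_comm, ← Finset.sum_neg_distrib]
  refine Finset.sum_congr rfl fun j _ => ?_
  rw [← Finset.sum_neg_distrib]
  refine Finset.sum_congr rfl fun k _ => ?_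
  rw [contr_contr, map_neg]
  ring

theorem path_sgn_left (e : ι → V) (a b c : Alt V ℂ) : path e (sgn a) b c = -path e a b c := by
  simp [path, contr_sgn, Finset.sum_neg_distrib]

theorem path_sgn_middle (e : ι → V) (a b c : Alt V ℂ) : path e a (sgn b) c = path e a b c := by
  simp [path, contr_sgn]

theorem path_sgn_right (e : ι → V) (a b c : Alt V ℂ) : path e a b (sgn c) = -path e a b c := by
  simp [path, contr_sgn, Finset.sum_neg_distrib]

/-- The constant term of a double bracket sees 1-form parts of two entries and the 2-form part of
the third. The outer contraction hits either b or c, and the hit factor is the middle of the path.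
-/
theorem ev0_poisson_poisson (e : ι → V) (a b c : Alt V ℂ) :
    ev0 (poisson e a (poisson e b c)) = path e a b c - path e a c b := by
  simp only [ev0_poisson, contr_poisson, contr_sgn, map_add, map_neg, ev0_sgn, path,
    Finset.mul_sum, ← Finset.sum_add_distrib, ← Finset.sum_sub_distrib]
  refine Finset.sum_congr rfl fun j _ => Finset.sum_congr rfl fun k _ => ?_
  ring

theorem ev0_poisson_poisson_left (e : ι → V) (a b c : Alt V ℂ) :
    ev0 (poisson e (poisson e a b) c) = path e c a b - path e c b a := by
  rw [← ev0_poisson_poisson, ev0_poisson, ev0_poisson]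
  exact Finset.sum_congr rfl fun j _ => mul_comm _ _

/-- The graded Jacobi identity, for elements which need not be homogeneous. -/
theorem poisson_jacobi (e : ι → V) (a b c : Alt V ℂ) :
    poisson e a (poisson e b c) = poisson e (poisson e a b) c + (1 / 2 : ℂ) •
      (poisson e b (poisson e a c) + poisson e b (poisson e (sgn a) c) +
        poisson e (sgn b) (poisson e a c) - poisson e (sgn b) (poisson e (sgn a) c)) := by
  let R := compRight (poisson e) (poisson e)
  refine sub_eq_zero.mp (trilin_eq_zero (T := R -
    (compLeft (poisson e) (poisson e) + (1 / 2 : ℂ) • (R.flip + R.flip.compl₁₂ sgn LinearMap.id +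
      R.flip.compl₁₂ LinearMap.id sgn - R.flip.compl₁₂ sgn sgn)))
    (fun X a b c => ?_) (fun a b c => ?_) a b c)
  · simp only [R, LinearMap.sub_apply, LinearMap.add_apply, LinearMap.smul_apply,
      LinearMap.flip_apply, compLeft_apply, compRight_apply,
      LinearMap.compl₁₂_apply, LinearMap.id_apply, map_sub, map_add, map_smul, contr_poisson,
      contr_sgn, sgn_sgn, sgn_poisson, map_neg, LinearMap.neg_apply]
    module
  · simp only [R, LinearMap.sub_apply, LinearMap.add_apply, LinearMap.smul_apply,
      LinearMap.flip_apply, compLeft_apply, compRight_apply,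
      LinearMap.compl₁₂_apply, LinearMap.id_apply, map_sub, map_add, map_smul,
      ev0_poisson_poisson, ev0_poisson_poisson_left, path_sgn_left, path_sgn_middle,
      path_sgn_right, smul_eq_mul]
    -- Up to reversal there is one path for each choice of the middle entry; with a common
    -- orientation the terms cancel.
    rw [path_swap e c a b, path_swap e c b a, path_swap e b c a]
    ring

/-- Bracketing with an odd element is an odd derivation of the wedge product. -/
theorem poisson_wedge (e : ι → V) (a b c : Alt V ℂ) (ha : sgn a = -a) :
    poisson e a (wedge b c) = wedge (poisson e a b) c + wedge (sgn b) (poisson e a c) := by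
  simp only [poisson_apply, map_sum, LinearMap.sum_apply, ← Finset.sum_add_distrib]
  refine Finset.sum_congr rfl fun j _ => ?_
  -- Since `a` is odd, its contractions are even and commute with every form, so they can be moved
  -- past `sgn b`.
  have h : sgn (contr (e j) a) = contr (e j) a := by
    have := contr_sgn (e j) a
    rw [ha, map_neg] at this
    exact (neg_injective this).symm
  have comm : ∀ y, wedge (contr (e j) a) y = wedge y (contr (e j) a) := fun y => by
    rw [wedge_comm, h]
    module
  rw [contr_wedge, h, map_add, wedge_assoc, ← wedge_assoc _ (sgn b), comm (sgn b), wedge_assoc]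

end Poisson

/-! ### Orthonormal bases -/

section Orthonormal

variable {V : Type*} [AddCommGroup V] [Module ℂ V] [FiniteDimensional ℂ V]

/-- Nondegeneracy makes the diagonal entries of an orthogonal basis nonzero, and over ℂ they have
square roots by which the vectors can be divided. -/
theorem exists_orthonormal_basis (B : LinearMap.BilinForm ℂ V) (hs : B.IsSymm)
    (hB : B.Nondegenerate) : ∃ e : Module.Basis (Fin (Module.finrank ℂ V)) ℂ V,
      ∀ i j, B (e i) (e j) = if i = j then 1 else 0 := by
  obtain ⟨v, hv⟩ := LinearMap.BilinForm.exists_orthogonal_basis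
    (LinearMap.BilinForm.isSymm_iff.mp hs)
  have hne : ∀ i, B (v i) (v i) ≠ 0 :=
    LinearMap.IsOrthoᵢ.not_isOrtho_basis_self_of_separatingLeft hv hB.1
  choose s hs using fun i => IsAlgClosed.exists_pow_nat_eq (B (v i) (v i)) two_pos
  have hs0 : ∀ i, s i ≠ 0 := fun i h => hne i (by rw [← hs i, h]; simp)
  refine ⟨v.isUnitSMul (w := fun i => (s i)⁻¹) fun i => (inv_ne_zero (hs0 i)).isUnit, fun i j => ?_⟩
  simp only [Module.Basis.isUnitSMul_apply, map_smul, LinearMap.smul_apply, smul_eq_mul]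
  split_ifs with h
  · subst h
    rw [← hs i]
    field_simp [hs0 i]
  · have : B (v i) (v j) = 0 := hv h
    simp [this]

/-- For Ω of degree w ≥ 1 the sign (-1)^(w+1) is the parity of ι Ω, of degree w - 1, so it is `sgn`
applied after the contraction. For w = 0 both sides vanish. -/
theorem superPoisson_eq_poisson (B : LinearMap.BilinForm ℂ V) (hB : B.Nondegenerate)
    {n : ℕ} (e : Module.Basis (Fin n) ℂ V) (he : ∀ i j, B (e i) (e j) = if i = j then 1 else 0) :
    superPoisson B hB = (2 : ℂ) • poisson e := by
  refine linearMap_ext fun w Ω => LinearMap.ext fun Ω' => ?_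
  rw [superPoisson_orthonormal B hB e he, LinearMap.smul_apply, LinearMap.smul_apply, poisson_apply,
    mul_smul]
  congr 1
  rw [Finset.smul_sum]
  refine Finset.sum_congr rfl fun j _ => ?_
  rw [contract_eq_contr]
  cases w with
  | zero => simp
  | succ w => simp [pow_succ]

end Orthonormal

/-! ### Insertion -/

section Insertion

variable {V W W' : Type*} [AddCommGroup V] [Module ℂ V] [AddCommGroup W] [Module ℂ W]
  [AddCommGroup W'] [Module ℂ W']

@[simp]
theorem slotTot_hom_zero (a : V [⋀^Fin 0]→ₗ[ℂ] W) : slotTot (hom V W 0 a) = 0 := by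
  simp [slotTot]

@[simp]
theorem slotTot_hom_succ (k : ℕ) (a : V [⋀^Fin (k + 1)]→ₗ[ℂ] W) :
    slotTot (hom V W (k + 1) a) = hom V (V →ₗ[ℂ] W) k (slot k a) := by
  simp [slotTot]

theorem post_evalAt_slotTot (Y : V) (a : Alt V W) : post (evalAt Y) (slotTot a) = contr Y a := by
  have : post (evalAt Y) ∘ₗ slotTot = contr (W := W) Y := by
    refine linearMap_ext fun k a => ?_
    cases k with
    | zero => simp
    | succ k =>
      rw [LinearMap.comp_apply, slotTot_hom_succ, post_hom, contr_hom_succ]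
      rfl
  exact LinearMap.congr_fun this a

theorem ev0_slotTot (a : Alt V W) (Y : V) : ev0 (slotTot a) Y = ev0 (contr Y a) := by
  rw [← post_evalAt_slotTot, ev0_post]
  rfl

theorem post_id (a : Alt V W) : post LinearMap.id a = a := by
  have : post LinearMap.id = (LinearMap.id : Alt V W →ₗ[ℂ] Alt V W) :=
    linearMap_ext fun k a => by
      rw [post_hom]
      rfl
  exact LinearMap.congr_fun this a

theorem coord_post (f : W →ₗ[ℂ] W') (k : ℕ) (a : Alt V W) (v : Fin k → V) :
    coord (fun k : ℕ => V [⋀^Fin k]→ₗ[ℂ] W') k (post f a) v =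
      f (coord (fun k : ℕ => V [⋀^Fin k]→ₗ[ℂ] W) k a v) := by
  have : coord (fun k : ℕ => V [⋀^Fin k]→ₗ[ℂ] W') k ∘ₗ post f =
      LinearMap.compAlternatingMapₗ ℂ f ∘ₗ coord (fun k : ℕ => V [⋀^Fin k]→ₗ[ℂ] W) k := by
    refine linearMap_ext fun j a => ?_
    simp only [LinearMap.comp_apply, post_hom]
    by_cases h : j = k
    · subst h
      rw [coord_incl_self, coord_incl_self]
      rfl
    · rw [coord_incl_ne h, coord_incl_ne h, map_zero]
  exact DFunLike.congr_fun (LinearMap.congr_fun this a) v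

theorem ext_post {ι : Type*} {f : ι → W →ₗ[ℂ] W'} (hf : ∀ x y, (∀ i, f i x = f i y) → x = y)
    {a b : Alt V W} (h : ∀ i, post (f i) a = post (f i) b) : a = b :=
  grSum_ext fun k => AlternatingMap.ext fun v => hf _ _ fun i => by
    rw [← coord_post, ← coord_post, h]

/-- The free slot is the first argument of the original map and X fills the next one; exchanging
them gives the sign. -/
theorem contr_slotTot (X : V) (a : Alt V W) : contr X (slotTot a) = -slotTot (contr X a) :=
  ext_post (f := evalAt) (fun _ _ h => LinearMap.ext h) fun Y => by
    rw [← contr_post, post_evalAt_slotTot, map_neg, post_evalAt_slotTot, contr_contr]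

theorem insertion_apply (F : Alt V W) (G : Alt V V) :
    insertion F G = shuffleProd evalAt G (slotTot F) := rfl

/-- Needed for Lie derivatives: contracting ι_X F₀ once more leaves the cochain [X, Y] of degree 0,
whose insertion has to be recognized as a contraction. -/
theorem insertion_hom_zero (x : V [⋀^Fin 0]→ₗ[ℂ] V) (a : Alt V W) :
    insertion a (hom V V 0 x) = contr (x Fin.elim0) a := by
  have : insertion.flip (hom V V 0 x) - contr (W := W) (x Fin.elim0) = 0 := by
    refine lin_eq_zero (-1) (fun X a => ?_) fun a => ?_
    · simp only [LinearMap.sub_apply, LinearMap.flip_apply, insertion_apply, map_sub,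
        contr_shuffleProd, contr_hom_zero, map_zero, LinearMap.zero_apply, zero_add, sgn_hom,
        pow_zero, one_smul, contr_slotTot, map_neg, contr_contr X]
      module
    · simp only [LinearMap.sub_apply, LinearMap.flip_apply, insertion_apply, map_sub,
        ev0_shuffleProd, ev0_hom_zero]
      rw [← ev0_slotTot]
      exact sub_self _
  exact sub_eq_zero.mp (LinearMap.congr_fun this a)

end Insertion

/-! ### The differential of the trivial cohomology -/

section LieDerivative

variable {g : Type*} [LieRing g] [LieAlgebra ℂ g]

/-- The Lie derivative, up to its sign. -/
def lieDer (X : g) : Alt g ℂ →ₗ[ℂ] Alt g ℂ :=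
  insertion.flip (contr X (hom g g 2 (lieMap g)))

theorem ev0_lieDer (X : g) (a : Alt g ℂ) : ev0 (lieDer X a) = 0 := by
  simp [lieDer, insertion_apply]

/-- The vector Y goes either into ad X, which leaves the insertion of [X, Y], or into `a`. In the
latter case the odd degree of ad X and the sign from `contr_slotTot` cancel. -/
theorem contr_lieDer (X Y : g) (a : Alt g ℂ) :
    contr Y (lieDer X a) = contr ⁅X, Y⁆ a + lieDer X (contr Y a) := by
  simp only [lieDer, LinearMap.flip_apply, insertion_apply, contr_shuffleProd, contr_hom_succ,
    contr_slotTot, sgn_hom]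
  rw [← insertion_apply, insertion_hom_zero]
  simp
  rfl

/-- The Jacobi identity of the Lie algebra enters here: by it, the defect commutes with every
contraction. The minus sign is there because `lieDer X` is the negative of the Lie derivative. -/
theorem lieDer_lieDer (X Y : g) (a : Alt g ℂ) :
    lieDer X (lieDer Y a) - lieDer Y (lieDer X a) = -lieDer ⁅X, Y⁆ a := by
  have : lieDer X ∘ₗ lieDer Y - lieDer Y ∘ₗ lieDer X + lieDer ⁅X, Y⁆ = 0 := by
    refine lin_eq_zero 1 (fun Z a => ?_) fun a => by simp [ev0_lieDer]
    simp only [LinearMap.add_apply, LinearMap.sub_apply, LinearMap.comp_apply, map_add, map_sub,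
      contr_lieDer, leibniz_lie X Y Z, contr_add]
    module
  exact eq_neg_of_add_eq_zero_left (LinearMap.congr_fun this a)

/-- Cartan's formula, with -`lieDer X` as the Lie derivative. -/
theorem contr_dTriv (X : g) (a : Alt g ℂ) :
    contr X (dTriv g a) = -lieDer X a - dTriv g (contr X a) := by
  simp only [dTriv, lieDer, LinearMap.neg_apply, LinearMap.flip_apply, insertion_apply, map_neg,
    contr_shuffleProd, contr_slotTot, sgn_hom]
  simp only [even_two.neg_one_pow, one_smul, neg_add, neg_neg, sub_neg_eq_add]

theorem ev0_dTriv (a : Alt g ℂ) : ev0 (dTriv g a) = 0 := by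
  simp [dTriv, insertion_apply]

theorem dTriv_lieDer (X : g) (a : Alt g ℂ) : dTriv g (lieDer X a) = lieDer X (dTriv g a) := by
  have : dTriv g ∘ₗ lieDer X - lieDer X ∘ₗ dTriv g = 0 := by
    refine lin_eq_zero (-1) (fun Z a => ?_) fun a => by simp [ev0_lieDer, ev0_dTriv]
    have := lieDer_lieDer X Z a
    simp only [LinearMap.sub_apply, LinearMap.comp_apply, map_add, map_sub,
      contr_lieDer, contr_dTriv, map_neg]
    refine sub_eq_zero.mp (Eq.trans ?_ (eq_neg_iff_add_eq_zero.mp this))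
    module
  exact sub_eq_zero.mp (LinearMap.congr_fun this a)

/-- By Cartan's formula, and since ∂ commutes with Lie derivatives, ∂² commutes with all
contractions; it has no constant terms, so it vanishes. -/
theorem dTriv_dTriv (a : Alt g ℂ) : dTriv g (dTriv g a) = 0 := by
  have : dTriv g ∘ₗ dTriv g = 0 := by
    refine lin_eq_zero 1 (fun Z a => ?_) fun a => by simp [ev0_dTriv]
    simp only [LinearMap.comp_apply, map_sub, contr_dTriv, map_neg, dTriv_lieDer]
    module
  exact LinearMap.congr_fun this a

end LieDerivative

/-! ### Comparison of the brackets -/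

section Compare

variable {V W : Type*} [AddCommGroup V] [Module ℂ V] [AddCommGroup W] [Module ℂ W]

/-- Expand the inserted value as x = ∑ B(x, e_j) e_j. -/
theorem insertion_eq_sum (B : LinearMap.BilinForm ℂ V) {n : ℕ} (e : Module.Basis (Fin n) ℂ V)
    (he : ∀ i j, B (e i) (e j) = if i = j then 1 else 0) (F : Alt V W) (G : Alt V V) :
    insertion F G =
      ∑ j, shuffleProd (LinearMap.lsmul ℂ W) (post (B.flip (e j)) G) (contr (e j) F) := by
  have h : (evalAt : V →ₗ[ℂ] (V →ₗ[ℂ] W) →ₗ[ℂ] W) =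
      ∑ j, (LinearMap.lsmul ℂ W).compl₁₂ (B.flip (e j)) (evalAt (e j)) := by
    refine LinearMap.ext fun x => LinearMap.ext fun φ => ?_
    have hx : x = ∑ j, B x (e j) • e j := by
      conv_lhs => rw [← e.sum_repr x]
      refine Finset.sum_congr rfl fun i _ => ?_
      congr 1
      conv_rhs => rw [← e.sum_repr x, map_sum, LinearMap.sum_apply]
      simp [he]
    change φ x = _
    conv_lhs => rw [hx, map_sum]
    simp [evalAt]
  rw [insertion_apply, h, shuffleProd_sum]
  refine Finset.sum_congr rfl fun j _ => ?_
  rw [← shuffleProd_post, post_evalAt_slotTot]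

theorem insertion_eq_sum_wedge (B : LinearMap.BilinForm ℂ V) {n : ℕ}
    (e : Module.Basis (Fin n) ℂ V) (he : ∀ i j, B (e i) (e j) = if i = j then 1 else 0)
    (F : Alt V ℂ) (G : Alt V V) :
    insertion F G = ∑ j, wedge (post (B.flip (e j)) G) (contr (e j) F) := by
  have : LinearMap.lsmul ℂ ℂ = LinearMap.mul ℂ ℂ := by ext; simp
  rw [insertion_eq_sum B e he, this]
  rfl

theorem post_insertion (B : LinearMap.BilinForm ℂ V) {n : ℕ}
    (e : Module.Basis (Fin n) ℂ V) (he : ∀ i j, B (e i) (e j) = if i = j then 1 else 0)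
    (f : W →ₗ[ℂ] ℂ) (F : Alt V W) (G : Alt V V) :
    post f (insertion F G) = ∑ j, wedge (post (B.flip (e j)) G) (contr (e j) (post f F)) := by
  have : (LinearMap.lsmul ℂ W).compr₂ f = (LinearMap.mul ℂ ℂ).compl₁₂ LinearMap.id f := by
    ext; simp
  rw [insertion_eq_sum B e he, map_sum]
  refine Finset.sum_congr rfl fun j _ => ?_
  rw [post_shuffleProd, this, ← shuffleProd_post, contr_post, post_id]
  rfl

/-- The bridge between cochains and forms. Since Ĉ is skew, its last argument Z moves to the front
at the cost of (-1)^k, the parity of ι_Z Ĉ; the constant -2 inverts the normalization of Φ. -/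
theorem post_cycIncl (B : LinearMap.BilinForm ℂ V) (Z : V) (C : Cyc B) :
    post (B.flip Z) (cycIncl B C) = (-2 : ℂ) • sgn (contr Z (Phi B C)) := by
  have : post (B.flip Z) ∘ₗ cycIncl B = (-2 : ℂ) • (sgn ∘ₗ contr Z ∘ₗ Phi B) := by
    refine linearMap_ext fun k C => ?_
    simp only [LinearMap.comp_apply, LinearMap.smul_apply, cycIncl, Phi, lift_incl, map_smul,
      contr_hom_succ, sgn_hom, Submodule.subtype_apply, post_hom, smul_smul]
    rw [← map_smul]
    congr 1
    ext v
    have h := map_rotate (theta B k C) (Fin.snoc v Z)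
    have h1 := theta_apply B k C (Fin.snoc v Z)
    rw [Fin.snoc_last, Fin.init_snoc] at h h1
    have h2 : (theta B k C).curryLeft Z v = (-1) ^ k * (B (C.1 v)) Z := h.trans (by rw [h1])
    rw [AlternatingMap.smul_apply, h2, smul_eq_mul]
    have : ((-1 : ℂ) ^ k) * (-1) ^ k = 1 := by rw [← mul_pow]; simp
    simp
    linear_combination -(B (C.1 v) Z) * this
  exact LinearMap.congr_fun this C

/-- Only the constant term is lost in `PhiInv`, and contractions do not see it. -/
theorem contr_Phi_PhiInv [FiniteDimensional ℂ V] (B : LinearMap.BilinForm ℂ V)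
    (hB : B.Nondegenerate) (Z : V) (Ω : Alt V ℂ) : contr Z (Phi B (PhiInv B hB Ω)) = contr Z Ω := by
  have : contr Z ∘ₗ Phi B ∘ₗ PhiInv B hB = contr Z := by
    refine linearMap_ext fun k a => ?_
    cases k with
    | zero => simp [PhiInv]
    | succ k =>
      rw [LinearMap.comp_apply, LinearMap.comp_apply, Phi_PhiInv]
      exact coord_incl_ne (Nat.succ_ne_zero k) a
  exact LinearMap.congr_fun this Ω

/-- Only the parities of the entries matter, so the hypotheses are eigenvalue equations for `sgn`.
This serves shifted degrees and contracted forms as well. -/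
theorem poisson_skew_of_sgn {ι : Type*} [Fintype ι] (e : ι → V) {p q : ℤ} {a b : Alt V ℂ}
    (ha : sgn a = (-1 : ℂ) ^ p • a) (hb : sgn b = (-1 : ℂ) ^ q • b) :
    poisson e a b = -((-1 : ℂ) ^ (p * q) • poisson e b a) := by
  rw [poisson_skew, ha, hb, zpow_mul]
  rcases p.even_or_odd with hp | hp <;> rcases q.even_or_odd with hq | hq <;>
  simp only [hp.neg_one_zpow, hq.neg_one_zpow, one_zpow, map_smul, LinearMap.smul_apply] <;> module

theorem poisson_jacobi_of_sgn {ι : Type*} [Fintype ι] (e : ι → V) {p q : ℤ} {a b : Alt V ℂ}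
    (ha : sgn a = (-1 : ℂ) ^ p • a) (hb : sgn b = (-1 : ℂ) ^ q • b) (c : Alt V ℂ) :
    poisson e a (poisson e b c) =
      poisson e (poisson e a b) c + (-1 : ℂ) ^ (p * q) • poisson e b (poisson e a c) := by
  rw [poisson_jacobi, ha, hb, zpow_mul]
  rcases p.even_or_odd with hp | hp <;> rcases q.even_or_odd with hq | hq <;>
  simp only [hp.neg_one_zpow, hq.neg_one_zpow, one_zpow, map_smul, LinearMap.smul_apply] <;> module

theorem sgn_Phi_cycHom (B : LinearMap.BilinForm ℂ V) (p : ℕ) (F : cyc B p) :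
    sgn (Phi B (cycHom B p F)) = (-1 : ℂ) ^ (p + 1) • Phi B (cycHom B p F) := by
  simp only [Phi, lift_incl, LinearMap.smul_apply, LinearMap.comp_apply, map_smul, sgn_hom]
  rw [smul_comm]

/-- The Gerstenhaber bracket of cyclic cochains corresponds to the super Poisson bracket. -/
theorem gerstenhaber_cycIncl [FiniteDimensional ℂ V] (B : LinearMap.BilinForm ℂ V)
    (hs : B.IsSymm) (hB : B.Nondegenerate) (C C' : Cyc B) :
    gerstenhaber (cycIncl B C) (cycIncl B C') =
      cycIncl B (PhiInv B hB (superPoisson B hB (Phi B C) (Phi B C'))) := by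
  obtain ⟨e, he⟩ := exists_orthonormal_basis B hs hB
  suffices h : gerstenhaber.compl₁₂ (cycIncl B) (cycIncl B) =
      ((superPoisson B hB).compl₁₂ (Phi B) (Phi B)).compr₂ (cycIncl B ∘ₗ PhiInv B hB) from
    LinearMap.congr_fun (LinearMap.congr_fun h C) C'
  refine bilin_ext fun p q F G => ?_
  simp only [LinearMap.compl₁₂_apply, LinearMap.compr₂_apply, LinearMap.comp_apply]
  have hger : gerstenhaber (cycIncl B (cycHom B p F)) (cycIncl B (cycHom B q G)) =
      (-1 : ℂ) ^ ((p + 1) * (q + 1)) •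
        insertion (cycIncl B (cycHom B p F)) (cycIncl B (cycHom B q G)) -
      insertion (cycIncl B (cycHom B q G)) (cycIncl B (cycHom B p F)) := by
    simp only [cycIncl, lift_incl, LinearMap.comp_apply, gerstenhaber, bilinExt_hom]
    rfl
  rw [hger]
  -- By nondegeneracy it suffices to test the values against every Z.
  refine ext_post (f := fun Z => B.flip Z) (fun x y h => ?_) fun Z => ?_
  · refine sub_eq_zero.mp (hB.1 _ fun Z => ?_)
    have : B x Z = B y Z := h Z
    rw [map_sub, LinearMap.sub_apply, this, sub_self]
  rw [post_cycIncl, contr_Phi_PhiInv, superPoisson_eq_poisson B hB e he, map_sub, map_smul,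
    post_insertion B e he, post_insertion B e he]
  simp only [post_cycIncl, map_smul, LinearMap.smul_apply, ← Finset.smul_sum, ← poisson_apply,
    contr_poisson, map_add, sgn_poisson, sgn_sgn]
  have h1 := sgn_Phi_cycHom B p F
  have h2 := sgn_Phi_cycHom B q G
  have h3 : sgn (sgn (contr Z (Phi B (cycHom B p F)))) =
      (-1 : ℂ) ^ p • sgn (contr Z (Phi B (cycHom B p F))) := by
    have := contr_sgn Z (Phi B (cycHom B p F))
    rw [h1, map_smul] at this
    have h4 : sgn (contr Z (Phi B (cycHom B p F))) =
        (-1 : ℂ) ^ p • contr Z (Phi B (cycHom B p F)) := by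
      rw [← neg_eq_iff_eq_neg.mpr this, pow_succ]
      module
    rw [h4, map_smul, h4]
  -- The term of ι_Z{Φ(F), Φ(G)} in which Z hits Φ(G) already is the one from G ∘ F. In the other
  -- term the entries have parities p and q + 1; exchanging them and removing `sgn` from Φ(G)
  -- produces the sign (-1)^((p+1)(q+1)) of F ∘ G.
  rw [poisson_skew_of_sgn e (p := (p : ℤ)) (q := ((q + 1 : ℕ) : ℤ)) (by rw [zpow_natCast, h3])
    (b := sgn (Phi B (cycHom B q G))) (by rw [zpow_natCast, h2, map_smul, h2]),
    h2, map_smul, LinearMap.smul_apply, ← Nat.cast_mul, zpow_natCast,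
    show (p + 1) * (q + 1) = p * (q + 1) + (q + 1) by ring, pow_add]
  module

end Compare

/-! ### The differentials as brackets with F₀ -/

section Differential

variable {g : Type*} [LieRing g] [LieAlgebra ℂ g]

/-- Invariance and symmetry of B make B([X, Y], Z) invariant under cyclic permutations. -/
theorem lieMap_mem_cyc {B : LinearMap.BilinForm ℂ g} (hB : IsQuadratic g B) :
    lieMap g ∈ cyc B 2 := by
  intro Y
  rw [hat_apply, hat_apply]
  have h := hB.invariant (Y 0) (Y 1) (Y 2)
  have h2 := hB.symm.eq (Y 1) ⁅Y 0, Y 2⁆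
  have h3 : -⁅Y 0, Y 2⁆ = ⁅Y 2, Y 0⁆ := lie_skew _ _
  change B ⁅Y 0, Y 1⁆ (Y 2) = (-1) ^ 2 * B ⁅Y 2, Y 0⁆ (Y 1)
  rw [h, h2, ← h3, map_neg, LinearMap.neg_apply]
  ring

/-- The Lie bracket as a cyclic cochain. -/
def lieCyc {B : LinearMap.BilinForm ℂ g} (hB : IsQuadratic g B) : Cyc B :=
  cycHom B 2 ⟨lieMap g, lieMap_mem_cyc hB⟩

theorem cycIncl_lieCyc {B : LinearMap.BilinForm ℂ g} (hB : IsQuadratic g B) :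
    cycIncl B (lieCyc hB) = hom g g 2 (lieMap g) := by
  simp [cycIncl, lieCyc]

theorem sgn_Phi_lieCyc {B : LinearMap.BilinForm ℂ g} (hB : IsQuadratic g B) :
    sgn (Phi B (lieCyc hB)) = -Phi B (lieCyc hB) := by
  rw [lieCyc, sgn_Phi_cycHom]
  norm_num

variable [FiniteDimensional ℂ g]

/-- In the basis expansion of the insertion of F₀, the coefficients B(F₀, e_j) are -2 `sgn` (ι_{e_j}
Φ(F₀)). The minus sign in `dTriv` makes this the bracket with Φ(F₀). -/
theorem superPoisson_lieCyc {B : LinearMap.BilinForm ℂ g} (hB : IsQuadratic g B) (a : Alt g ℂ) :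
    superPoisson B hB.nondegenerate (Phi B (lieCyc hB)) a = dTriv g a := by
  obtain ⟨e, he⟩ := exists_orthonormal_basis B hB.symm hB.nondegenerate
  rw [superPoisson_eq_poisson B hB.nondegenerate e he, dTriv, LinearMap.neg_apply,
    LinearMap.flip_apply, insertion_eq_sum_wedge B e he, ← cycIncl_lieCyc hB]
  simp only [post_cycIncl, map_smul, LinearMap.smul_apply, ← Finset.smul_sum, ← poisson_apply]
  module

theorem dTriv_wedge {B : LinearMap.BilinForm ℂ g} (hB : IsQuadratic g B) (a b : Alt g ℂ) :
    dTriv g (wedge a b) = wedge (dTriv g a) b + wedge (sgn a) (dTriv g b) := by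
  obtain ⟨e, he⟩ := exists_orthonormal_basis B hB.symm hB.nondegenerate
  simp only [← superPoisson_lieCyc hB, superPoisson_eq_poisson B hB.nondegenerate e he,
    LinearMap.smul_apply, poisson_wedge _ _ _ _ (sgn_Phi_lieCyc hB), map_smul, smul_add]

/-- This is the Jacobi identity with the odd element Φ(F₀) as first entry; oddness collapses the
four sign terms to the single one with `sgn a`. -/
theorem dTriv_superPoisson {B : LinearMap.BilinForm ℂ g} (hB : IsQuadratic g B) (a b : Alt g ℂ) :
    dTriv g (superPoisson B hB.nondegenerate a b) =
      superPoisson B hB.nondegenerate (dTriv g a) b +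
        superPoisson B hB.nondegenerate (sgn a) (dTriv g b) := by
  obtain ⟨e, he⟩ := exists_orthonormal_basis B hB.symm hB.nondegenerate
  simp only [← superPoisson_lieCyc hB, superPoisson_eq_poisson B hB.nondegenerate e he,
    LinearMap.smul_apply, map_smul]
  rw [poisson_jacobi, sgn_Phi_lieCyc hB]
  simp only [map_neg, LinearMap.neg_apply]
  module

/-- The bracket comparison with F₀ as first entry: Φ carries d to ∂. -/
theorem dAd_cycIncl {B : LinearMap.BilinForm ℂ g} (hB : IsQuadratic g B) (C : Cyc B) :
    dAd g (cycIncl B C) = cycIncl B (PhiInv B hB.nondegenerate (dTriv g (Phi B C))) := by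
  rw [dAd, ← cycIncl_lieCyc hB, gerstenhaber_cycIncl B hB.symm hB.nondegenerate,
    superPoisson_lieCyc]

end Differential

/-! ### Linear algebra of graded spaces and quotients -/

section General

theorem exists_bilin_quotient {M X : Type*} [AddCommGroup M] [Module ℂ M] [AddCommGroup X]
    [Module ℂ X] (S : Submodule ℂ M) (f : M →ₗ[ℂ] M →ₗ[ℂ] X) (h1 : ∀ s ∈ S, ∀ b, f s b = 0)
    (h2 : ∀ s ∈ S, ∀ a, f a s = 0) :
    ∃ f' : (M ⧸ S) →ₗ[ℂ] (M ⧸ S) →ₗ[ℂ] X,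
      ∀ a b, f' (Submodule.Quotient.mk a) (Submodule.Quotient.mk b) = f a b := by
  let f₁ : (M ⧸ S) →ₗ[ℂ] M →ₗ[ℂ] X := S.liftQ f fun s hs => LinearMap.ext (h1 s hs)
  refine ⟨(S.liftQ f₁.flip fun s hs => LinearMap.ext fun x => ?_).flip, fun a b => rfl⟩
  obtain ⟨a, rfl⟩ := Submodule.Quotient.mk_surjective S x
  exact h2 s hs a

/-- A family of submodules is a direct sum decomposition as soon as it spans and there are linear
maps, each of which is injective on one of the submodules and vanishes on the other ones. -/
theorem isInternal_of_detect {L X : Type*} [AddCommGroup L] [Module ℂ L] [AddCommGroup X]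
    [Module ℂ X] {G : ℤ → Submodule ℂ L} (P : ℤ → L →ₗ[ℂ] X)
    (hinj : ∀ n, ∀ x ∈ G n, P n x = 0 → x = 0) (hz : ∀ m n, m ≠ n → ∀ x ∈ G m, P n x = 0)
    (htop : ⨆ n, G n = ⊤) : DirectSum.IsInternal G := by
  refine DirectSum.isInternal_submodule_of_iSupIndep_of_iSup_eq_top (fun n => ?_) htop
  rw [Submodule.disjoint_def]
  intro x hx hx'
  refine hinj n x hx ?_
  have : ⨆ j, ⨆ _ : j ≠ n, G j ≤ LinearMap.ker (P n) := iSup₂_le fun m hm y hy => hz m n hm y hy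
  exact this hx'

variable {M : ℕ → Type*} [∀ k, AddCommGroup (M k)] [∀ k, Module ℂ (M k)]

theorem degPart_natCast (k : ℕ) : degPart M k = LinearMap.range (incl M k) := by
  refine le_antisymm (iSup₂_le fun j hj => ?_) (le_iSup₂_of_le k rfl le_rfl)
  obtain rfl : j = k := by exact_mod_cast hj
  exact le_rfl

theorem degPart_of_neg {n : ℤ} (h : n < 0) : degPart M n = ⊥ :=
  le_bot_iff.mp (iSup₂_le fun j hj => by omega)

theorem incl_mem_degPart {k : ℕ} {n : ℤ} (h : (k : ℤ) = n) (a : M k) : incl M k a ∈ degPart M n := by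
  subst h
  rw [degPart_natCast]
  exact ⟨a, rfl⟩

theorem eq_zero_or_of_mem_degPart {n : ℤ} {x : GrSum M} (h : x ∈ degPart M n) :
    x = 0 ∨ ∃ (k : ℕ) (a : M k), (k : ℤ) = n ∧ x = incl M k a := by
  rcases lt_or_ge n 0 with hn | hn
  · rw [degPart_of_neg hn] at h
    exact Or.inl h
  · obtain ⟨k, rfl⟩ := Int.eq_ofNat_of_zero_le hn
    rw [degPart_natCast] at h
    obtain ⟨a, rfl⟩ := h
    exact Or.inr ⟨k, a, rfl, rfl⟩

/-- The projection onto the part of degree `k`. -/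
def proj (M : ℕ → Type*) [∀ k, AddCommGroup (M k)] [∀ k, Module ℂ (M k)] (k : ℕ) :
    GrSum M →ₗ[ℂ] GrSum M :=
  incl M k ∘ₗ coord M k

theorem proj_incl_self (k : ℕ) (a : M k) : proj M k (incl M k a) = incl M k a := by
  rw [proj, LinearMap.comp_apply, coord_incl_self]

theorem proj_incl_ne {j k : ℕ} (h : j ≠ k) (a : M j) : proj M k (incl M j a) = 0 := by
  rw [proj, LinearMap.comp_apply, coord_incl_ne h, map_zero]

theorem proj_mem_degPart (k : ℕ) (x : GrSum M) : proj M k x ∈ degPart M k :=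
  incl_mem_degPart rfl _

theorem proj_of_mem_degPart {k : ℕ} {x : GrSum M} (h : x ∈ degPart M k) : proj M k x = x := by
  rw [degPart_natCast] at h
  obtain ⟨a, rfl⟩ := h
  exact proj_incl_self k a

theorem proj_of_mem_degPart_ne {k : ℕ} {n : ℤ} (hn : (k : ℤ) ≠ n) {x : GrSum M}
    (h : x ∈ degPart M n) : proj M k x = 0 := by
  rcases eq_zero_or_of_mem_degPart h with rfl | ⟨j, a, rfl, rfl⟩
  · exact map_zero _
  · exact proj_incl_ne (fun e => hn (by rw [e])) a

theorem exists_eq_sum_proj (x : GrSum M) : ∃ s : Finset ℕ, x = ∑ k ∈ s, proj M k x := by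
  classical
  exact ⟨DFinsupp.support (x : ⨁ k, M k), (DirectSum.sum_support_of (β := M) x).symm⟩

end General

/-! ### Classes and induced operations -/

section Coh

variable {C A : Type*} [AddCommGroup C] [Module ℂ C] [AddCommGroup A] [Module ℂ A]

theorem cls_eq_zero_iff (i : C →ₗ[ℂ] A) (d : A →ₗ[ℂ] A) (c : cocycles i d) :
    cls i d c = 0 ↔ i c ∈ LinearMap.range (d ∘ₗ i) := by
  rw [cls, Submodule.Quotient.mk_eq_zero]
  rfl

theorem cls_surjective (i : C →ₗ[ℂ] A) (d : A →ₗ[ℂ] A) : Function.Surjective (cls i d) :=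
  Submodule.Quotient.mk_surjective _

theorem cls_mem_cohPart {i : C →ₗ[ℂ] A} {d : A →ₗ[ℂ] A} {S : Submodule ℂ C} {c : cocycles i d}
    (h : (c : C) ∈ S) : cls i d c ∈ cohPart i d S :=
  ⟨c, h, rfl⟩

theorem cohPart_bot (i : C →ₗ[ℂ] A) (d : A →ₗ[ℂ] A) : cohPart i d ⊥ = ⊥ := by
  rw [eq_bot_iff]
  rintro x ⟨c, hc, rfl⟩
  have : c = 0 := Subtype.ext hc
  rw [this, map_zero]
  exact zero_mem _

/-- An operation on a complex which is compatible with the differential induces an operation on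
the cohomology. -/
theorem exists_induced (d : A →ₗ[ℂ] A) (op : A →ₗ[ℂ] A →ₗ[ℂ] A)
    (h : ∀ a b, d a = 0 → d b = 0 → d (op a b) = 0)
    (hl : ∀ a b, d b = 0 → op (d a) b ∈ LinearMap.range d)
    (hr : ∀ a b, d a = 0 → op a (d b) ∈ LinearMap.range d) :
    ∃ μ : Coh LinearMap.id d →ₗ[ℂ] Coh LinearMap.id d →ₗ[ℂ] Coh LinearMap.id d,
      ∀ a b c : cocycles LinearMap.id d, (c : A) = op a b →
        μ (cls _ d a) (cls _ d b) = cls _ d c := by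
  let f : cocycles LinearMap.id d →ₗ[ℂ] cocycles LinearMap.id d →ₗ[ℂ] Coh LinearMap.id d :=
    LinearMap.mk₂ ℂ (fun a b => cls LinearMap.id d ⟨op a b, h a b a.2 b.2⟩)
      (fun a a' b => by
        rw [cls, cls, cls, ← Submodule.Quotient.mk_add]
        congr 1
        ext
        simp)
      (fun r a b => by
        rw [cls, cls, ← Submodule.Quotient.mk_smul]
        congr 1
        ext
        simp)
      (fun a b b' => by
        rw [cls, cls, cls, ← Submodule.Quotient.mk_add]
        congr 1
        ext
        simp)
      (fun r a b => by
        rw [cls, cls, ← Submodule.Quotient.mk_smul]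
        congr 1
        ext
        simp)
  obtain ⟨μ, hμ⟩ := exists_bilin_quotient
    ((coboundaries LinearMap.id d).submoduleOf (cocycles LinearMap.id d)) f (fun s hs b => by
    obtain ⟨t, ht⟩ := hs
    refine (cls_eq_zero_iff _ _ _).mpr ?_
    change op s b ∈ LinearMap.range d
    have : (s : A) = d t := ht.symm
    rw [this]
    exact hl _ _ b.2) (fun s hs b => by
    obtain ⟨t, ht⟩ := hs
    refine (cls_eq_zero_iff _ _ _).mpr ?_
    change op b s ∈ LinearMap.range d
    have : (s : A) = d t := ht.symm
    rw [this]
    exact hr _ _ b.2)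
  refine ⟨μ, fun a b c hc => (hμ a b).trans ?_⟩
  exact congrArg (cls _ d) (Subtype.ext hc.symm)

end Coh

/-! ### Transport of graded structures along a bijection -/

section Transport

variable {L L' : Type*} [AddCommGroup L] [Module ℂ L] [AddCommGroup L'] [Module ℂ L']
  {G : ℤ → Submodule ℂ L} {G' : ℤ → Submodule ℂ L'}

theorem mem_iff_of_map_eq {f : L ≃ₗ[ℂ] L'} (hf : ∀ n, (G n).map f.toLinearMap = G' n) (n : ℤ)
    (x : L) : x ∈ G n ↔ f x ∈ G' n := by
  rw [← hf]
  exact ⟨fun h => ⟨x, h, rfl⟩, fun ⟨y, hy, e⟩ => f.injective e ▸ hy⟩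

theorem isInternal_of_equiv {f : L ≃ₗ[ℂ] L'} (hf : ∀ n, (G n).map f.toLinearMap = G' n)
    (h : DirectSum.IsInternal G') : DirectSum.IsInternal G := by
  rw [DirectSum.isInternal_submodule_iff_iSupIndep_and_iSup_eq_top] at h ⊢
  obtain rfl : (fun n => (G n).map f.toLinearMap) = G' := funext hf
  refine ⟨?_, ?_⟩
  · exact (iSupIndep_map_orderIso_iff (Submodule.orderIsoMapComap f)).mp h.1
  · have h2 := h.2
    rw [← Submodule.map_iSup] at h2
    exact (Submodule.orderIsoMapComap f).injective (h2.trans (map_top _).symm)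

theorem isGradedAssoc_of_equiv {f : L ≃ₗ[ℂ] L'} (hf : ∀ n, (G n).map f.toLinearMap = G' n)
    {m : L →ₗ[ℂ] L →ₗ[ℂ] L} {m' : L' →ₗ[ℂ] L' →ₗ[ℂ] L'} (hm : ∀ x y, f (m x y) = m' (f x) (f y))
    (h : IsGradedAssoc G' m') : IsGradedAssoc G m where
  internal := isInternal_of_equiv hf h.internal
  mul_mem p q x y hx hy := by
    rw [mem_iff_of_map_eq hf] at hx hy ⊢
    rw [hm]
    exact h.mul_mem p q _ _ hx hy
  assoc x y z := f.injective <| by simp only [hm, h.assoc]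

theorem isGradedLie_of_equiv {f : L ≃ₗ[ℂ] L'} (hf : ∀ n, (G n).map f.toLinearMap = G' n)
    {m : L →ₗ[ℂ] L →ₗ[ℂ] L} {m' : L' →ₗ[ℂ] L' →ₗ[ℂ] L'} (hm : ∀ x y, f (m x y) = m' (f x) (f y))
    (h : IsGradedLie G' m') : IsGradedLie G m where
  internal := isInternal_of_equiv hf h.internal
  bracket_mem p q x y hx hy := by
    rw [mem_iff_of_map_eq hf] at hx hy ⊢
    rw [hm]
    exact h.bracket_mem p q _ _ hx hy
  skew p q x y hx hy := f.injective <| by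
    rw [mem_iff_of_map_eq hf] at hx hy
    rw [map_neg, map_smul, hm, hm]
    exact h.skew p q _ _ hx hy
  jacobi p q x y z hx hy := f.injective <| by
    rw [mem_iff_of_map_eq hf] at hx hy
    simp only [map_add, map_smul, hm]
    exact h.jacobi p q _ _ _ hx hy

end Transport

/-! ### Degrees -/

section Degrees

variable {V W : Type*} [AddCommGroup V] [Module ℂ V] [AddCommGroup W] [Module ℂ W]

theorem hom_mem_degPart {k : ℕ} {n : ℤ} (h : (k : ℤ) = n) (a : V [⋀^Fin k]→ₗ[ℂ] W) :
    hom V W k a ∈ degPart (fun k : ℕ => V [⋀^Fin k]→ₗ[ℂ] W) n :=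
  incl_mem_degPart (M := fun k : ℕ => V [⋀^Fin k]→ₗ[ℂ] W) h a

theorem sgn_of_mem_degPart {n : ℤ} {a : Alt V W}
    (h : a ∈ degPart (fun k : ℕ => V [⋀^Fin k]→ₗ[ℂ] W) n) : sgn a = (-1 : ℂ) ^ n • a := by
  rcases eq_zero_or_of_mem_degPart h with rfl | ⟨k, a, rfl, rfl⟩
  · simp
  · rw [sgn_hom, zpow_natCast]

theorem ev0_of_mem_degPart {n : ℤ} (hn : n ≠ 0) {a : Alt V W}
    (h : a ∈ degPart (fun k : ℕ => V [⋀^Fin k]→ₗ[ℂ] W) n) : ev0 a = 0 := by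
  rcases eq_zero_or_of_mem_degPart h with rfl | ⟨k, a, rfl, rfl⟩
  · simp
  · cases k with
    | zero => exact absurd rfl hn
    | succ k => exact ev0_hom_succ k a

theorem proj_zero_eq_zero_iff (a : Alt V W) :
    proj (fun k : ℕ => V [⋀^Fin k]→ₗ[ℂ] W) 0 a = 0 ↔ ev0 a = 0 := by
  constructor
  · intro h
    have h2 := congrArg (coord (fun k : ℕ => V [⋀^Fin k]→ₗ[ℂ] W) 0) h
    rw [proj, LinearMap.comp_apply, coord_incl_self] at h2
    rw [← coord_zero_eq a Fin.elim0, h2, map_zero]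
    rfl
  · intro h
    have : coord (fun k : ℕ => V [⋀^Fin k]→ₗ[ℂ] W) 0 a = 0 :=
      AlternatingMap.ext fun v => by rw [coord_zero_eq, h]; rfl
    rw [proj, LinearMap.comp_apply, this, map_zero]

theorem contr_mem_degPart (X : V) {n : ℤ} {a : Alt V W}
    (h : a ∈ degPart (fun k : ℕ => V [⋀^Fin k]→ₗ[ℂ] W) n) :
    contr X a ∈ degPart (fun k : ℕ => V [⋀^Fin k]→ₗ[ℂ] W) (n - 1) := by
  rcases eq_zero_or_of_mem_degPart h with rfl | ⟨k, a, rfl, rfl⟩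
  · simp
  · cases k with
    | zero => rw [contr_hom_zero]; exact zero_mem _
    | succ k => rw [contr_hom_succ]; exact hom_mem_degPart (by push_cast; ring) _

theorem wedge_mem_degPart {m n : ℤ} {a b : Alt V ℂ}
    (ha : a ∈ degPart (fun k : ℕ => V [⋀^Fin k]→ₗ[ℂ] ℂ) m)
    (hb : b ∈ degPart (fun k : ℕ => V [⋀^Fin k]→ₗ[ℂ] ℂ) n) :
    wedge a b ∈ degPart (fun k : ℕ => V [⋀^Fin k]→ₗ[ℂ] ℂ) (m + n) := by
  rcases eq_zero_or_of_mem_degPart ha with rfl | ⟨k, a, rfl, rfl⟩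
  · simp
  rcases eq_zero_or_of_mem_degPart hb with rfl | ⟨l, b, rfl, rfl⟩
  · simp
  rw [wedge, shuffleProd_hom]
  exact hom_mem_degPart (by push_cast; ring) _

theorem poisson_mem_degPart {ι : Type*} [Fintype ι] (e : ι → V) {m n : ℤ} {a b : Alt V ℂ}
    (ha : a ∈ degPart (fun k : ℕ => V [⋀^Fin k]→ₗ[ℂ] ℂ) m)
    (hb : b ∈ degPart (fun k : ℕ => V [⋀^Fin k]→ₗ[ℂ] ℂ) n) :
    poisson e a b ∈ degPart (fun k : ℕ => V [⋀^Fin k]→ₗ[ℂ] ℂ) (m + n - 2) := by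
  rw [poisson_apply]
  refine sum_mem fun j _ => ?_
  have h := contr_mem_degPart (e j) ha
  rw [sgn_of_mem_degPart h, show m + n - 2 = (m - 1) + (n - 1) by ring, map_smul]
  exact Submodule.smul_mem _ _ (wedge_mem_degPart h (contr_mem_degPart (e j) hb))

variable {g : Type*} [LieRing g] [LieAlgebra ℂ g]

theorem dTriv_mem_degPart {n : ℤ} {a : Alt g ℂ}
    (h : a ∈ degPart (fun k : ℕ => g [⋀^Fin k]→ₗ[ℂ] ℂ) n) :
    dTriv g a ∈ degPart (fun k : ℕ => g [⋀^Fin k]→ₗ[ℂ] ℂ) (n + 1) := by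
  rcases eq_zero_or_of_mem_degPart h with rfl | ⟨k, a, rfl, rfl⟩
  · simp
  · rw [dTriv, LinearMap.neg_apply, LinearMap.flip_apply, insertion_apply]
    cases k with
    | zero => rw [slotTot_hom_zero, map_zero, neg_zero]; exact zero_mem _
    | succ k =>
      rw [slotTot_hom_succ, shuffleProd_hom]
      exact neg_mem (hom_mem_degPart (by push_cast; ring) _)

theorem dTriv_proj (k : ℕ) (a : Alt g ℂ) :
    dTriv g (proj (fun k : ℕ => g [⋀^Fin k]→ₗ[ℂ] ℂ) k a) = proj _ (k + 1) (dTriv g a) := by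
  suffices h : dTriv g ∘ₗ proj (fun k : ℕ => g [⋀^Fin k]→ₗ[ℂ] ℂ) k = proj _ (k + 1) ∘ₗ dTriv g from
    LinearMap.congr_fun h a
  refine linearMap_ext fun j a => ?_
  have h := dTriv_mem_degPart (hom_mem_degPart rfl a)
  simp only [LinearMap.comp_apply]
  by_cases hj : j = k
  · subst hj
    rw [proj_incl_self]
    exact (proj_of_mem_degPart (k := j + 1) (by exact_mod_cast h)).symm
  · rw [proj_incl_ne hj, map_zero,
      proj_of_mem_degPart_ne (k := k + 1) (n := (j : ℤ) + 1) (by push_cast; omega) h]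

end Degrees

/-! ### Gradings of H*, H₊* and H*/ℂ -/

section Trivial

variable {g : Type*} [LieRing g] [LieAlgebra ℂ g]

/-- The space of forms of degree `n`. -/
abbrev formDeg (g : Type*) [LieRing g] [LieAlgebra ℂ g] (n : ℤ) : Submodule ℂ (Alt g ℂ) :=
  degPart (fun k : ℕ => g [⋀^Fin k]→ₗ[ℂ] ℂ) n

/-- The component of degree `k` of a form. -/
abbrev formProj (g : Type*) [LieRing g] [LieAlgebra ℂ g] (k : ℕ) : Alt g ℂ →ₗ[ℂ] Alt g ℂ :=
  proj (fun k : ℕ => g [⋀^Fin k]→ₗ[ℂ] ℂ) k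

/-- The class of a closed form. -/
def formCls (c : Alt g ℂ) (h : dTriv g c = 0) : HTriv g :=
  cls LinearMap.id (dTriv g) ⟨c, h⟩

theorem exists_formCls (x : HTriv g) : ∃ c h, x = formCls c h := by
  obtain ⟨c, rfl⟩ := cls_surjective _ _ x
  exact ⟨c.1, c.2, rfl⟩

theorem formCls_eq_zero_iff (c : Alt g ℂ) (h : dTriv g c = 0) :
    formCls c h = 0 ↔ ∃ b, dTriv g b = c :=
  cls_eq_zero_iff _ _ _

theorem formCls_sub (a b : Alt g ℂ) (ha : dTriv g a = 0) (hb : dTriv g b = 0) :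
    formCls a ha - formCls b hb = formCls (a - b) (by rw [map_sub, ha, hb, sub_zero]) := rfl

theorem formCls_add (a b : Alt g ℂ) (ha : dTriv g a = 0) (hb : dTriv g b = 0) :
    formCls a ha + formCls b hb = formCls (a + b) (by rw [map_add, ha, hb, add_zero]) := rfl

theorem formCls_neg (a : Alt g ℂ) (ha : dTriv g a = 0) :
    -formCls a ha = formCls (-a) (by rw [map_neg, ha, neg_zero]) := rfl

theorem formCls_smul (r : ℂ) (a : Alt g ℂ) (ha : dTriv g a = 0) :
    r • formCls a ha = formCls (r • a) (by rw [map_smul, ha, smul_zero]) := rfl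

theorem formCls_congr {a b : Alt g ℂ} (h : a = b) (ha : dTriv g a = 0) :
    formCls a ha = formCls b (h ▸ ha) := by
  subst h
  rfl

theorem mem_HTrivDeg {n : ℤ} {x : HTriv g} :
    x ∈ HTrivDeg g n ↔ ∃ c h, c ∈ formDeg g n ∧ x = formCls c h := by
  constructor
  · rintro ⟨c, hc, rfl⟩
    exact ⟨c.1, c.2, hc, rfl⟩
  · rintro ⟨c, h, hc, rfl⟩
    exact ⟨⟨c, h⟩, hc, rfl⟩

theorem HTrivDeg_of_neg {n : ℤ} (hn : n < 0) : HTrivDeg g n = ⊥ := by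
  rw [HTrivDeg, degPart_of_neg hn, cohPart_bot]

/-- The shift by 2 does not change parities, so the signs required by the shifted grading are those
of the form degrees. -/
theorem sgn_of_mem_formDeg_add_two {n : ℤ} {a : Alt g ℂ} (h : a ∈ formDeg g (n + 2)) :
    sgn a = (-1 : ℂ) ^ n • a := by
  rw [sgn_of_mem_degPart h, zpow_add₀ (by norm_num)]
  norm_num

theorem dTriv_formProj_eq_zero {c : Alt g ℂ} (h : dTriv g c = 0) (k : ℕ) :
    dTriv g (formProj g k c) = 0 := by
  rw [dTriv_proj, h, map_zero]

/-- As ∂ is homogeneous, the components of a closed form are closed; hence the graded parts span the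
cohomology. -/
theorem exists_formCls_eq_sum (c : Alt g ℂ) (h : dTriv g c = 0) :
    ∃ s : Finset ℕ, formCls c h =
      ∑ k ∈ s, formCls (formProj g k c) (dTriv_formProj_eq_zero h k) := by
  obtain ⟨s, hs⟩ := exists_eq_sum_proj (M := fun k : ℕ => g [⋀^Fin k]→ₗ[ℂ] ℂ) c
  refine ⟨s, ?_⟩
  let D : cocycles LinearMap.id (dTriv g) →ₗ[ℂ] HTriv g := Submodule.mkQ _
  change D ⟨c, h⟩ = ∑ k ∈ s, D ⟨formProj g k c, dTriv_formProj_eq_zero h k⟩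
  rw [← map_sum]
  congr 1
  ext1
  simpa using hs

/-- The map which detects the component of degree `k` of a class. -/
def detect (g : Type*) [LieRing g] [LieAlgebra ℂ g] (k : ℕ) :
    HTriv g →ₗ[ℂ] Alt g ℂ ⧸ LinearMap.range (dTriv g) :=
  Submodule.liftQ _ ((LinearMap.range (dTriv g)).mkQ ∘ₗ formProj g k ∘ₗ
    (cocycles LinearMap.id (dTriv g)).subtype) (by
      rintro c ⟨b, hb⟩
      have hb' : (c : Alt g ℂ) = dTriv g b := hb.symm
      refine (Submodule.Quotient.mk_eq_zero _).mpr ?_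
      change formProj g k (c : Alt g ℂ) ∈ _
      rw [hb']
      -- A coboundary has no constant term, and in degree k + 1 its component is ∂ of the component
      -- of degree k.
      cases k with
      | zero =>
        rw [(proj_zero_eq_zero_iff _).mpr (ev0_dTriv b)]
        exact zero_mem _
      | succ k =>
        rw [← dTriv_proj]
        exact ⟨_, rfl⟩)

theorem detect_formCls (k : ℕ) (c : Alt g ℂ) (h : dTriv g c = 0) :
    detect g k (formCls c h) = Submodule.Quotient.mk (formProj g k c) := rfl

theorem eq_zero_of_detect {k : ℕ} {x : HTriv g} (hx : x ∈ HTrivDeg g k) (h : detect g k x = 0) :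
    x = 0 := by
  obtain ⟨c, hc, hd, rfl⟩ := mem_HTrivDeg.mp hx
  rw [detect_formCls, Submodule.Quotient.mk_eq_zero, proj_of_mem_degPart hd] at h
  exact (formCls_eq_zero_iff c hc).mpr h

theorem detect_of_ne {k : ℕ} {n : ℤ} (hn : (k : ℤ) ≠ n) {x : HTriv g} (hx : x ∈ HTrivDeg g n) :
    detect g k x = 0 := by
  obtain ⟨c, hc, hd, rfl⟩ := mem_HTrivDeg.mp hx
  rw [detect_formCls, proj_of_mem_degPart_ne hn hd, Submodule.Quotient.mk_zero]

/-- Describing H₊ by closed forms without constant term makes its stability under the wedge product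
and the range of Φ visible. -/
theorem mem_HPlus {x : HTriv g} : x ∈ HPlus g ↔ ∃ c h, ev0 c = 0 ∧ x = formCls c h := by
  constructor
  · intro hx
    have : HPlus g ≤ cohPart LinearMap.id (dTriv g) (LinearMap.ker ev0) := by
      refine iSup₂_le fun n hn => ?_
      rintro _ ⟨c, hc, rfl⟩
      exact ⟨c, ev0_of_mem_degPart (by omega) hc, rfl⟩
    obtain ⟨c, hc, rfl⟩ := this hx
    exact ⟨c.1, c.2, hc, rfl⟩
  · rintro ⟨c, h, hc, rfl⟩
    obtain ⟨s, hs⟩ := exists_formCls_eq_sum c h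
    rw [hs]
    refine sum_mem fun k _ => ?_
    rcases Nat.eq_zero_or_pos k with rfl | hk
    · rw [formCls_congr ((proj_zero_eq_zero_iff c).mpr hc)]
      exact zero_mem _
    · have hk' : (1 : ℤ) ≤ k := by exact_mod_cast hk
      exact (le_iSup₂_of_le (f := fun (n : ℤ) (_ : 1 ≤ n) => HTrivDeg g n) (k : ℤ) hk' le_rfl)
        (mem_HTrivDeg.mpr ⟨_, _, proj_mem_degPart k c, rfl⟩)

theorem HTrivDeg_le_HPlus {n : ℤ} (hn : 1 ≤ n) : HTrivDeg g n ≤ HPlus g :=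
  le_iSup₂_of_le (f := fun (n : ℤ) (_ : 1 ≤ n) => HTrivDeg g n) n hn le_rfl

/-- H₊ meets H⁰ trivially; this gives injectivity of the map from H₊ to the quotient by constants.
-/
theorem eq_zero_of_mem_HPlus {x : HTriv g} (hx : x ∈ HPlus g) (h0 : x ∈ HTrivDeg g 0) : x = 0 := by
  obtain ⟨c, h, hc, rfl⟩ := mem_HPlus.mp hx
  refine eq_zero_of_detect (k := 0) h0 ?_
  rw [detect_formCls, (proj_zero_eq_zero_iff c).mpr hc, Submodule.Quotient.mk_zero]

theorem mem_HPlusDeg {n : ℤ} {x : HPlus g} :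
    x ∈ HPlusDeg g n ↔ x = 0 ∨ 1 ≤ n ∧ (x : HTriv g) ∈ HTrivDeg g n := by
  rw [HPlusDeg]
  split_ifs with h
  · constructor
    · exact fun hx => Or.inr ⟨h, hx⟩
    · rintro (rfl | hx)
      · exact zero_mem _
      · exact hx.2
  · simp [h]

theorem isInternal_HPlusDeg : DirectSum.IsInternal (HPlusDeg g) := by
  refine isInternal_of_detect
    -- For n < 0 this detects degree 0, which is harmless because the parts with n < 1 are zero and
    -- the nonzero ones have positive degree.
    (P := fun n => detect g n.toNat ∘ₗ (HPlus g).subtype) ?_ ?_ ?_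
  · intro n x hx h
    rcases mem_HPlusDeg.mp hx with rfl | ⟨hn, hx⟩
    · rfl
    · refine Subtype.ext (eq_zero_of_detect (k := n.toNat) ?_ h)
      rwa [Int.toNat_of_nonneg (by omega)]
  · intro m n hmn x hx
    rcases mem_HPlusDeg.mp hx with rfl | ⟨hm, hx⟩
    · exact map_zero _
    · exact detect_of_ne (by omega) hx
  · refine Submodule.map_injective_of_injective (HPlus g).injective_subtype ?_
    rw [Submodule.map_top, Submodule.range_subtype, Submodule.map_iSup]
    refine le_antisymm (iSup_le fun n => Submodule.map_subtype_le _ _) (iSup₂_le fun n hn => ?_)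
    refine le_trans ?_ (le_iSup _ n)
    intro x hx
    exact ⟨⟨x, HTrivDeg_le_HPlus hn hx⟩, mem_HPlusDeg.mpr (Or.inr ⟨hn, hx⟩), rfl⟩

/-- The class of a closed form modulo the constants. -/
def quotCls (c : Alt g ℂ) (h : dTriv g c = 0) : HQuot g :=
  Submodule.Quotient.mk (formCls c h)

theorem exists_quotCls (y : HQuot g) : ∃ c h, y = quotCls c h := by
  obtain ⟨x, rfl⟩ := Submodule.Quotient.mk_surjective _ y
  obtain ⟨c, h, rfl⟩ := exists_formCls x
  exact ⟨c, h, rfl⟩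

theorem quotCls_add (a b : Alt g ℂ) (ha : dTriv g a = 0) (hb : dTriv g b = 0) :
    quotCls a ha + quotCls b hb = quotCls (a + b) (by rw [map_add, ha, hb, add_zero]) := by
  rw [quotCls, quotCls, quotCls, ← Submodule.Quotient.mk_add, formCls_add]

theorem quotCls_neg (a : Alt g ℂ) (ha : dTriv g a = 0) :
    -quotCls a ha = quotCls (-a) (by rw [map_neg, ha, neg_zero]) := by
  rw [quotCls, quotCls, ← Submodule.Quotient.mk_neg, formCls_neg]

theorem quotCls_smul (r : ℂ) (a : Alt g ℂ) (ha : dTriv g a = 0) :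
    r • quotCls a ha = quotCls (r • a) (by rw [map_smul, ha, smul_zero]) := by
  rw [quotCls, quotCls, ← Submodule.Quotient.mk_smul, formCls_smul]

theorem quotCls_congr {a b : Alt g ℂ} (h : a = b) (ha : dTriv g a = 0) :
    quotCls a ha = quotCls b (h ▸ ha) := by
  subst h
  rfl

theorem quotCls_eq {a b : Alt g ℂ} (ha : dTriv g a = 0) (hb : dTriv g b = 0)
    (h : a - b ∈ formDeg g 0) : quotCls a ha = quotCls b hb := by
  rw [quotCls, quotCls, Submodule.Quotient.eq, formCls_sub]
  exact mem_HTrivDeg.mpr ⟨_, _, h, rfl⟩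

theorem mem_HQuotDeg {n : ℤ} {y : HQuot g} :
    y ∈ HQuotDeg g n ↔ ∃ c h, c ∈ formDeg g n ∧ y = quotCls c h := by
  constructor
  · rintro ⟨x, hx, rfl⟩
    obtain ⟨c, h, hc, rfl⟩ := mem_HTrivDeg.mp hx
    exact ⟨c, h, hc, rfl⟩
  · rintro ⟨c, h, hc, rfl⟩
    exact ⟨formCls c h, mem_HTrivDeg.mpr ⟨c, h, hc, rfl⟩, rfl⟩

theorem HQuotDeg_of_nonpos {n : ℤ} (hn : n ≤ 0) : HQuotDeg g n = ⊥ := by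
  rcases hn.lt_or_eq with h | rfl
  · rw [HQuotDeg, HTrivDeg_of_neg h, Submodule.map_bot]
  · exact Submodule.mkQ_map_self _

/-- The map which detects the component of positive degree `k + 1` of a class modulo constants. -/
def detectQuot (g : Type*) [LieRing g] [LieAlgebra ℂ g] (k : ℕ) :
    HQuot g →ₗ[ℂ] Alt g ℂ ⧸ LinearMap.range (dTriv g) :=
  (HTrivDeg g 0).liftQ (detect g (k + 1)) fun _ hx => detect_of_ne (by omega) hx

theorem isInternal_HQuotDeg : DirectSum.IsInternal (fun n => HQuotDeg g (n + 2)) := by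
  refine isInternal_of_detect
    -- The part of index n consists of classes of form degree n + 2, detected by `detectQuot` at n +
    -- 1. If n + 2 ≤ 0 the part is zero, so the zero map will do.
    (P := fun n => if 0 ≤ n + 1 then detectQuot g (n + 1).toNat else 0) ?_ ?_ ?_
  · intro n x hx h
    by_cases hn : 0 ≤ n + 1
    · rw [if_pos hn] at h
      obtain ⟨x, hx, rfl⟩ := hx
      have h2 : x = 0 := by
        refine eq_zero_of_detect (k := (n + 1).toNat + 1) ?_ h
        push_cast
        rwa [Int.toNat_of_nonneg hn, add_assoc]
      rw [h2, map_zero]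
    · rw [HQuotDeg_of_nonpos (by omega)] at hx
      exact hx
  · intro m n hmn x hx
    by_cases hn : 0 ≤ n + 1
    · rw [if_pos hn]
      obtain ⟨x, hx, rfl⟩ := hx
      exact detect_of_ne (k := (n + 1).toNat + 1) (by push_cast; omega) hx
    · rw [if_neg hn]
      rfl
  · refine eq_top_iff.mpr fun y _ => ?_
    obtain ⟨c, h, rfl⟩ := exists_quotCls y
    obtain ⟨s, hs⟩ := exists_formCls_eq_sum c h
    have : quotCls c h = (HTrivDeg g 0).mkQ (formCls c h) := rfl
    rw [this, hs, map_sum]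
    refine sum_mem fun k _ => ?_
    refine (le_iSup (fun n => HQuotDeg g (n + 2)) ((k : ℤ) - 2)) ?_
    rw [sub_add_cancel]
    exact mem_HQuotDeg.mpr ⟨_, _, proj_mem_degPart k c, rfl⟩

end Trivial

/-! ### The products on the cohomologies -/

section Products

variable {g : Type*} [LieRing g] [LieAlgebra ℂ g] [FiniteDimensional ℂ g]
  {B : LinearMap.BilinForm ℂ g} (hB : IsQuadratic g B)

include hB in
theorem dTriv_wedge_eq_zero {a b : Alt g ℂ} (ha : dTriv g a = 0) (hb : dTriv g b = 0) :
    dTriv g (wedge a b) = 0 := by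
  rw [dTriv_wedge hB, ha, hb]
  simp

theorem dTriv_superPoisson_eq_zero {a b : Alt g ℂ} (ha : dTriv g a = 0) (hb : dTriv g b = 0) :
    dTriv g (superPoisson B hB.nondegenerate a b) = 0 := by
  rw [dTriv_superPoisson hB, ha, hb]
  simp

include hB in
-- ∂ is the bracket with an odd element and thus reverses parity. In particular `sgn` preserves
-- closed forms.
theorem sgn_dTriv (a : Alt g ℂ) : sgn (dTriv g a) = -dTriv g (sgn a) := by
  obtain ⟨e, he⟩ := exists_orthonormal_basis B hB.symm hB.nondegenerate
  simp only [← superPoisson_lieCyc hB, superPoisson_eq_poisson B hB.nondegenerate e he,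
    LinearMap.smul_apply, map_smul, sgn_poisson, sgn_Phi_lieCyc hB, map_neg, LinearMap.neg_apply,
    smul_neg]

include hB in
theorem exists_wedgeH : ∃ μ : HTriv g →ₗ[ℂ] HTriv g →ₗ[ℂ] HTriv g,
    ∀ a b c : cocycles LinearMap.id (dTriv g), (c : Alt g ℂ) = wedge (a : Alt g ℂ) b →
      μ (cls _ _ a) (cls _ _ b) = cls _ _ c := by
  refine exists_induced (dTriv g) wedge (fun a b => dTriv_wedge_eq_zero hB) (fun a b hb => ?_)
    (fun a b ha => ?_)
  · refine ⟨wedge a b, ?_⟩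
    rw [dTriv_wedge hB, hb, map_zero, add_zero]
  -- The sign in the Leibniz rule turns `sgn a` back into `a`, and ∂(`sgn a`) vanishes because `a`
  -- is closed.
  · refine ⟨wedge (sgn a) b, ?_⟩
    rw [dTriv_wedge hB, sgn_sgn]
    have := sgn_dTriv hB a
    rw [ha, map_zero] at this
    rw [neg_eq_zero.mp this.symm]
    simp

theorem exists_brH : ∃ μ : HTriv g →ₗ[ℂ] HTriv g →ₗ[ℂ] HTriv g,
    ∀ a b c : cocycles LinearMap.id (dTriv g),
      (c : Alt g ℂ) = superPoisson B hB.nondegenerate (a : Alt g ℂ) b →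
        μ (cls _ _ a) (cls _ _ b) = cls _ _ c := by
  refine exists_induced (dTriv g) (superPoisson B hB.nondegenerate)
    (fun a b => dTriv_superPoisson_eq_zero hB) (fun a b hb => ?_) (fun a b ha => ?_)
  · refine ⟨superPoisson B hB.nondegenerate a b, ?_⟩
    rw [dTriv_superPoisson hB, hb, map_zero, add_zero]
  · refine ⟨superPoisson B hB.nondegenerate (sgn a) b, ?_⟩
    rw [dTriv_superPoisson hB, sgn_sgn]
    have := sgn_dTriv hB a
    rw [ha, map_zero] at this
    rw [neg_eq_zero.mp this.symm]
    simp

/-- The wedge product on `H*(g)`. -/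
def wedgeH : HTriv g →ₗ[ℂ] HTriv g →ₗ[ℂ] HTriv g := (exists_wedgeH hB).choose

theorem wedgeH_formCls {a b : Alt g ℂ} (ha : dTriv g a = 0) (hb : dTriv g b = 0) :
    wedgeH hB (formCls a ha) (formCls b hb) =
      formCls (wedge a b) (dTriv_wedge_eq_zero hB ha hb) :=
  (exists_wedgeH hB).choose_spec ⟨a, ha⟩ ⟨b, hb⟩ ⟨wedge a b, _⟩ rfl

/-- The super Poisson bracket on `H*(g)`. -/
def brH : HTriv g →ₗ[ℂ] HTriv g →ₗ[ℂ] HTriv g := (exists_brH hB).choose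

theorem brH_formCls {a b : Alt g ℂ} (ha : dTriv g a = 0) (hb : dTriv g b = 0) :
    brH hB (formCls a ha) (formCls b hb) =
      formCls (superPoisson B hB.nondegenerate a b) (dTriv_superPoisson_eq_zero hB ha hb) :=
  (exists_brH hB).choose_spec ⟨a, ha⟩ ⟨b, hb⟩ ⟨superPoisson B hB.nondegenerate a b, _⟩ rfl

theorem wedgeH_mem_HPlus {x y : HTriv g} (hx : x ∈ HPlus g) (hy : y ∈ HPlus g) :
    wedgeH hB x y ∈ HPlus g := by
  obtain ⟨a, ha, ha0, rfl⟩ := mem_HPlus.mp hx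
  obtain ⟨b, hb, hb0, rfl⟩ := mem_HPlus.mp hy
  rw [wedgeH_formCls]
  exact mem_HPlus.mpr ⟨_, _, by rw [ev0_wedge, ha0, zero_mul], rfl⟩

/-- The wedge product on the reduced cohomology. -/
def wedgeP : HPlus g →ₗ[ℂ] HPlus g →ₗ[ℂ] HPlus g :=
  LinearMap.mk₂ ℂ (fun x y => ⟨wedgeH hB x y, wedgeH_mem_HPlus hB x.2 y.2⟩)
    (fun _ _ _ => Subtype.ext (by simp)) (fun _ _ _ => Subtype.ext (by simp))
    (fun _ _ _ => Subtype.ext (by simp)) (fun _ _ _ => Subtype.ext (by simp))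

theorem coe_wedgeP (x y : HPlus g) : (wedgeP hB x y : HTriv g) = wedgeH hB x y := rfl

theorem isGradedAssoc_wedgeP : IsGradedAssoc (HPlusDeg g) (wedgeP hB) where
  internal := isInternal_HPlusDeg
  mul_mem p q x y hx hy := by
    rcases mem_HPlusDeg.mp hx with rfl | ⟨hp, hx⟩
    · simp
    rcases mem_HPlusDeg.mp hy with rfl | ⟨hq, hy⟩
    · simp
    refine mem_HPlusDeg.mpr (Or.inr ⟨by omega, ?_⟩)
    obtain ⟨a, ha, ha', hx⟩ := mem_HTrivDeg.mp hx
    obtain ⟨b, hb, hb', hy⟩ := mem_HTrivDeg.mp hy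
    rw [coe_wedgeP, hx, hy, wedgeH_formCls]
    exact mem_HTrivDeg.mpr ⟨_, _, wedge_mem_degPart ha' hb', rfl⟩
  assoc x y z := by
    refine Subtype.ext ?_
    obtain ⟨a, ha, hx⟩ := exists_formCls (x : HTriv g)
    obtain ⟨b, hb, hy⟩ := exists_formCls (y : HTriv g)
    obtain ⟨c, hc, hz⟩ := exists_formCls (z : HTriv g)
    simp only [coe_wedgeP, hx, hy, hz, wedgeH_formCls]
    exact formCls_congr (wedge_assoc a b c) _

/-- Constants have zero contractions, so the bracket descends to the quotient by constants. -/
theorem superPoisson_constant_left {s : Alt g ℂ} (hs : s ∈ formDeg g 0) (b : Alt g ℂ) :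
    superPoisson B hB.nondegenerate s b = 0 := by
  obtain ⟨e, he⟩ := exists_orthonormal_basis B hB.symm hB.nondegenerate
  have : ∀ X, contr X s = 0 := fun X => by
    have := contr_mem_degPart X hs
    rwa [degPart_of_neg (by norm_num), Submodule.mem_bot] at this
  simp [superPoisson_eq_poisson B hB.nondegenerate e he, poisson_apply, this]

theorem superPoisson_constant_right {s : Alt g ℂ} (hs : s ∈ formDeg g 0) (b : Alt g ℂ) :
    superPoisson B hB.nondegenerate b s = 0 := by
  obtain ⟨e, he⟩ := exists_orthonormal_basis B hB.symm hB.nondegenerate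
  have : ∀ X, contr X s = 0 := fun X => by
    have := contr_mem_degPart X hs
    rwa [degPart_of_neg (by norm_num), Submodule.mem_bot] at this
  simp [superPoisson_eq_poisson B hB.nondegenerate e he, poisson_apply, this]

theorem exists_brQ : ∃ μ : HQuot g →ₗ[ℂ] HQuot g →ₗ[ℂ] HQuot g, ∀ x y : HTriv g,
    μ (Submodule.Quotient.mk x) (Submodule.Quotient.mk y) =
      Submodule.Quotient.mk (brH hB x y) := by
  refine exists_bilin_quotient (HTrivDeg g 0) ((brH hB).compr₂ (HTrivDeg g 0).mkQ)
    (fun s hs x => ?_) (fun s hs x => ?_)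
  · obtain ⟨c, hc, hc', rfl⟩ := mem_HTrivDeg.mp hs
    obtain ⟨a, ha, rfl⟩ := exists_formCls x
    rw [LinearMap.compr₂_apply, brH_formCls,
      formCls_congr (superPoisson_constant_left hB hc' a)]
    exact map_zero _
  · obtain ⟨c, hc, hc', rfl⟩ := mem_HTrivDeg.mp hs
    obtain ⟨a, ha, rfl⟩ := exists_formCls x
    rw [LinearMap.compr₂_apply, brH_formCls,
      formCls_congr (superPoisson_constant_right hB hc' a)]
    exact map_zero _

/-- The super Poisson bracket on `H*(g) / ℂ`. -/
def brQ : HQuot g →ₗ[ℂ] HQuot g →ₗ[ℂ] HQuot g := (exists_brQ hB).choose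

theorem brQ_mk (x y : HTriv g) : brQ hB (Submodule.Quotient.mk x) (Submodule.Quotient.mk y) =
    Submodule.Quotient.mk (brH hB x y) :=
  (exists_brQ hB).choose_spec x y

theorem brQ_quotCls {a b : Alt g ℂ} (ha : dTriv g a = 0) (hb : dTriv g b = 0) :
    brQ hB (quotCls a ha) (quotCls b hb) =
      quotCls (superPoisson B hB.nondegenerate a b) (dTriv_superPoisson_eq_zero hB ha hb) := by
  rw [quotCls, quotCls, brQ_mk, brH_formCls]
  rfl

theorem superPoisson_mem_formDeg {m n : ℤ} {a b : Alt g ℂ} (ha : a ∈ formDeg g m)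
    (hb : b ∈ formDeg g n) : superPoisson B hB.nondegenerate a b ∈ formDeg g (m + n - 2) := by
  obtain ⟨e, he⟩ := exists_orthonormal_basis B hB.symm hB.nondegenerate
  rw [superPoisson_eq_poisson B hB.nondegenerate e he, LinearMap.smul_apply, LinearMap.smul_apply]
  exact Submodule.smul_mem _ _ (poisson_mem_degPart e ha hb)

theorem superPoisson_skew {p q : ℤ} {a b : Alt g ℂ} (ha : sgn a = (-1 : ℂ) ^ p • a)
    (hb : sgn b = (-1 : ℂ) ^ q • b) :
    superPoisson B hB.nondegenerate a b =
      -((-1 : ℂ) ^ (p * q) • superPoisson B hB.nondegenerate b a) := by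
  obtain ⟨e, he⟩ := exists_orthonormal_basis B hB.symm hB.nondegenerate
  simp only [superPoisson_eq_poisson B hB.nondegenerate e he, LinearMap.smul_apply]
  rw [poisson_skew_of_sgn e ha hb]
  module

theorem superPoisson_jacobi {p q : ℤ} {a b : Alt g ℂ} (ha : sgn a = (-1 : ℂ) ^ p • a)
    (hb : sgn b = (-1 : ℂ) ^ q • b) (c : Alt g ℂ) :
    superPoisson B hB.nondegenerate a (superPoisson B hB.nondegenerate b c) =
      superPoisson B hB.nondegenerate (superPoisson B hB.nondegenerate a b) c +
        (-1 : ℂ) ^ (p * q) •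
          superPoisson B hB.nondegenerate b (superPoisson B hB.nondegenerate a c) := by
  obtain ⟨e, he⟩ := exists_orthonormal_basis B hB.symm hB.nondegenerate
  simp only [superPoisson_eq_poisson B hB.nondegenerate e he, LinearMap.smul_apply, map_smul]
  rw [poisson_jacobi_of_sgn e ha hb]
  module

theorem brQ_mem {p q : ℤ} {x y : HQuot g} (hx : x ∈ HQuotDeg g (p + 2))
    (hy : y ∈ HQuotDeg g (q + 2)) : brQ hB x y ∈ HQuotDeg g (p + q + 2) := by
  obtain ⟨a, ha, ha', rfl⟩ := mem_HQuotDeg.mp hx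
  obtain ⟨b, hb, hb', rfl⟩ := mem_HQuotDeg.mp hy
  rw [brQ_quotCls, show p + q + 2 = p + 2 + (q + 2) - 2 by ring]
  exact mem_HQuotDeg.mpr ⟨_, _, superPoisson_mem_formDeg hB ha' hb', rfl⟩

theorem brQ_skew {p q : ℤ} {x y : HQuot g} (hx : x ∈ HQuotDeg g (p + 2))
    (hy : y ∈ HQuotDeg g (q + 2)) : brQ hB x y = -((-1 : ℂ) ^ (p * q) • brQ hB y x) := by
  obtain ⟨a, ha, ha', rfl⟩ := mem_HQuotDeg.mp hx
  obtain ⟨b, hb, hb', rfl⟩ := mem_HQuotDeg.mp hy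
  rw [brQ_quotCls, brQ_quotCls, quotCls_smul, quotCls_neg]
  exact quotCls_congr (superPoisson_skew hB (sgn_of_mem_formDeg_add_two ha')
    (sgn_of_mem_formDeg_add_two hb')) _

theorem brQ_jacobi {p q : ℤ} {x y : HQuot g} (hx : x ∈ HQuotDeg g (p + 2))
    (hy : y ∈ HQuotDeg g (q + 2)) (z : HQuot g) :
    brQ hB x (brQ hB y z) =
      brQ hB (brQ hB x y) z + (-1 : ℂ) ^ (p * q) • brQ hB y (brQ hB x z) := by
  obtain ⟨a, ha, ha', rfl⟩ := mem_HQuotDeg.mp hx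
  obtain ⟨b, hb, hb', rfl⟩ := mem_HQuotDeg.mp hy
  obtain ⟨c, hc, rfl⟩ := exists_quotCls z
  simp only [brQ_quotCls, quotCls_smul, quotCls_add]
  exact quotCls_congr (superPoisson_jacobi hB (sgn_of_mem_formDeg_add_two ha')
    (sgn_of_mem_formDeg_add_two hb') c) _

theorem isGradedLie_brQ : IsGradedLie (fun n => HQuotDeg g (n + 2)) (brQ hB) where
  internal := isInternal_HQuotDeg
  bracket_mem _ _ _ _ hx hy := brQ_mem hB hx hy
  skew _ _ _ _ hx hy := brQ_skew hB hx hy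
  jacobi _ _ _ _ z hx hy := brQ_jacobi hB hx hy z

end Products

/-! ### The cyclic complex -/

section CyclicComplex

section Vector

variable {V : Type*} [AddCommGroup V] [Module ℂ V] {B : LinearMap.BilinForm ℂ V}

theorem ev0_Phi (C : Cyc B) : ev0 (Phi B C) = 0 := by
  have : ev0 ∘ₗ Phi B = 0 := linearMap_ext fun k C => by simp [Phi]
  exact LinearMap.congr_fun this C

theorem Phi_mem_degPart {n : ℤ} {C : Cyc B} (h : C ∈ degPart (fun k : ℕ => cyc B k) n) :
    Phi B C ∈ degPart (fun k : ℕ => V [⋀^Fin k]→ₗ[ℂ] ℂ) (n + 1) := by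
  rcases eq_zero_or_of_mem_degPart h with rfl | ⟨k, a, rfl, rfl⟩
  · simp
  · rw [Phi, lift_incl]
    exact Submodule.smul_mem _ _ (hom_mem_degPart (by push_cast; ring) _)

variable [FiniteDimensional ℂ V] (hB : B.Nondegenerate)

theorem Phi_PhiInv_of_ev0 {Ω : Alt V ℂ} (h : ev0 Ω = 0) : Phi B (PhiInv B hB Ω) = Ω :=
  ext_contr (fun X => contr_Phi_PhiInv B hB X Ω) (by rw [ev0_Phi, h])

theorem PhiInv_mem_degPart {n : ℤ} {Ω : Alt V ℂ}
    (h : Ω ∈ degPart (fun k : ℕ => V [⋀^Fin k]→ₗ[ℂ] ℂ) n) :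
    PhiInv B hB Ω ∈ degPart (fun k : ℕ => cyc B k) (n - 1) := by
  rcases eq_zero_or_of_mem_degPart h with rfl | ⟨k, a, rfl, rfl⟩
  · simp
  · cases k with
    | zero => simp [PhiInv]
    | succ k =>
      rw [PhiInv, lift_incl]
      exact Submodule.smul_mem _ _ (incl_mem_degPart (M := fun k : ℕ => cyc B k)
        (by push_cast; ring) _)

/-- The difference has zero contractions, so it equals its own component of degree 0. -/
theorem sub_Phi_PhiInv_mem (Ω : Alt V ℂ) :
    Ω - Phi B (PhiInv B hB Ω) ∈ degPart (fun k : ℕ => V [⋀^Fin k]→ₗ[ℂ] ℂ) 0 := by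
  have h : proj (fun k : ℕ => V [⋀^Fin k]→ₗ[ℂ] ℂ) 0 (Ω - Phi B (PhiInv B hB Ω)) =
      Ω - Phi B (PhiInv B hB Ω) := by
    refine ext_contr (fun X => ?_) ?_
    · rw [map_sub (contr X) Ω, contr_Phi_PhiInv, sub_self]
      exact contr_hom_zero X _
    · rw [← sub_eq_zero, ← map_sub, ← proj_zero_eq_zero_iff, map_sub, sub_eq_zero]
      exact proj_of_mem_degPart (proj_mem_degPart 0 _)
  rw [← h]
  exact proj_mem_degPart 0 _

include hB in
-- By `post_cycIncl` the cochain determines all contractions of its image under Φ, which has no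
-- constant term, and Φ is injective.
theorem cycIncl_injective : Function.Injective (cycIncl B) := by
  rw [← LinearMap.ker_eq_bot, LinearMap.ker_eq_bot']
  intro C hC
  have h : Phi B C = 0 := by
    refine eq_zero_of_contr (fun Z => ?_) (ev0_Phi C)
    have h := post_cycIncl B Z C
    rw [hC, map_zero] at h
    have h2 := (smul_eq_zero.mp h.symm).resolve_left (by norm_num)
    rw [← sgn_sgn (contr Z (Phi B C)), h2, map_zero]
  rw [← PhiInv_Phi B hB C, h, map_zero]

end Vector

/-! ### Φ as an isomorphism on cohomology -/

variable {g : Type*} [LieRing g] [LieAlgebra ℂ g] [FiniteDimensional ℂ g]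
  {B : LinearMap.BilinForm ℂ g} (hB : IsQuadratic g B)

/-- ∂ kills the constant that `PhiInv` drops. -/
theorem dTriv_Phi_PhiInv (Ω : Alt g ℂ) :
    dTriv g (Phi B (PhiInv B hB.nondegenerate Ω)) = dTriv g Ω := by
  rw [← sub_eq_zero, ← map_sub, ← neg_sub Ω, map_neg, neg_eq_zero]
  rcases eq_zero_or_of_mem_degPart (sub_Phi_PhiInv_mem hB.nondegenerate Ω) with h | ⟨k, a, hk, h⟩
  · rw [h, map_zero]
  · obtain rfl : k = 0 := by exact_mod_cast hk
    rw [h, dTriv, LinearMap.neg_apply, LinearMap.flip_apply, insertion_apply, slotTot_hom_zero,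
      map_zero, neg_zero]

include hB in
theorem isSubcomplex_cyc : IsSubcomplex (cycIncl B) (dAd g) where
  maps_to c := ⟨_, (dAd_cycIncl hB c).symm⟩
  sq_zero c := by
    rw [dAd_cycIncl hB, dAd_cycIncl hB, dTriv_Phi_PhiInv hB, dTriv_dTriv, map_zero, map_zero]

include hB in
-- Cocycles and coboundaries are both compared through this equivalence. The forward direction uses
-- that the values of ∂ have no constant term, so `PhiInv` loses nothing.
theorem dAd_cycIncl_eq_iff (c c' : Cyc B) :
    dAd g (cycIncl B c) = cycIncl B c' ↔ dTriv g (Phi B c) = Phi B c' := by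
  rw [dAd_cycIncl hB, (cycIncl_injective hB.nondegenerate).eq_iff]
  constructor
  · rintro rfl
    exact (Phi_PhiInv_of_ev0 _ (ev0_dTriv _)).symm
  · intro h
    rw [h, PhiInv_Phi]

include hB in
theorem mem_cocycles_cyc_iff (c : Cyc B) :
    c ∈ cocycles (cycIncl B) (dAd g) ↔ dTriv g (Phi B c) = 0 := by
  have h := dAd_cycIncl_eq_iff hB c 0
  rw [map_zero, map_zero] at h
  exact h

include hB in
theorem dTriv_Phi (c : cocycles (cycIncl B) (dAd g)) : dTriv g (Phi B (c : Cyc B)) = 0 :=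
  (mem_cocycles_cyc_iff hB c).mp c.2

/-- The map induced by `Φ` on cohomology. -/
def cohPhi : HCyc B →ₗ[ℂ] HTriv g :=
  Submodule.mapQ _ _ ((Phi B).restrict (p := cocycles (cycIncl B) (dAd g))
    (q := cocycles LinearMap.id (dTriv g)) fun c hc => (mem_cocycles_cyc_iff hB c).mp hc) (by
      rintro c ⟨b, hb⟩
      exact ⟨Phi B b, (dAd_cycIncl_eq_iff hB b c).mp hb⟩)

theorem cohPhi_cls (c : cocycles (cycIncl B) (dAd g)) :
    cohPhi hB (cls _ _ c) = formCls (Phi B (c : Cyc B)) (dTriv_Phi hB c) := rfl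

theorem cohPhi_injective : Function.Injective (cohPhi hB) := by
  rw [← LinearMap.ker_eq_bot, LinearMap.ker_eq_bot']
  intro x hx
  obtain ⟨c, rfl⟩ := cls_surjective _ _ x
  rw [cohPhi_cls, formCls_eq_zero_iff] at hx
  obtain ⟨b, hb⟩ := hx
  -- A primitive b may have a constant term; dropping it does not change ∂b.
  refine (cls_eq_zero_iff _ _ _).mpr ⟨PhiInv B hB.nondegenerate b, ?_⟩
  rw [LinearMap.comp_apply, dAd_cycIncl_eq_iff hB, dTriv_Phi_PhiInv hB, hb]

theorem exists_cohPhi_eq {a : Alt g ℂ} (ha : dTriv g a = 0) (h0 : ev0 a = 0) :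
    ∃ c : cocycles (cycIncl B) (dAd g), (c : Cyc B) = PhiInv B hB.nondegenerate a ∧
      cohPhi hB (cls _ _ c) = formCls a ha := by
  have h := Phi_PhiInv_of_ev0 hB.nondegenerate h0
  refine ⟨⟨PhiInv B hB.nondegenerate a, (mem_cocycles_cyc_iff hB _).mpr (by rw [h, ha])⟩, rfl, ?_⟩
  rw [cohPhi_cls]
  exact formCls_congr h _

theorem range_cohPhi : LinearMap.range (cohPhi hB) = HPlus g := by
  ext x
  constructor
  · rintro ⟨y, rfl⟩
    obtain ⟨c, rfl⟩ := cls_surjective _ _ y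
    exact mem_HPlus.mpr ⟨_, _, ev0_Phi _, rfl⟩
  · intro hx
    obtain ⟨a, ha, h0, rfl⟩ := mem_HPlus.mp hx
    obtain ⟨c, -, hc⟩ := exists_cohPhi_eq hB ha h0
    exact ⟨_, hc⟩

/-- A cochain with k arguments becomes a form of degree k + 1. For n < 1 there are no cochains of
degree n - 1, so nothing reaches H⁰. -/
theorem map_cohPhi (n : ℤ) :
    (HCycDeg B (n - 1)).map (cohPhi hB) = if 1 ≤ n then HTrivDeg g n else ⊥ := by
  split_ifs with hn
  · ext x
    constructor
    · rintro ⟨_, ⟨c, hc, rfl⟩, rfl⟩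
      refine mem_HTrivDeg.mpr ⟨_, _, ?_, rfl⟩
      have := Phi_mem_degPart (B := B) hc
      rwa [sub_add_cancel] at this
    · intro hx
      obtain ⟨a, ha, had, rfl⟩ := mem_HTrivDeg.mp hx
      obtain ⟨c, hc, hc'⟩ := exists_cohPhi_eq hB ha (ev0_of_mem_degPart (by omega) had)
      refine ⟨_, cls_mem_cohPart ?_, hc'⟩
      rw [hc]
      exact PhiInv_mem_degPart _ had
  · rw [HCycDeg, degPart_of_neg (by omega), cohPart_bot, Submodule.map_bot]

/-- The isomorphism from the cyclic to the reduced cohomology. -/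
def cohIsoPlus : HCyc B ≃ₗ[ℂ] HPlus g :=
  LinearEquiv.ofInjective (cohPhi hB) (cohPhi_injective hB) ≪≫ₗ
    LinearEquiv.ofEq _ _ (range_cohPhi hB)

theorem coe_cohIsoPlus (x : HCyc B) : (cohIsoPlus hB x : HTriv g) = cohPhi hB x := rfl

theorem map_cohIsoPlus (n : ℤ) :
    (HCycDeg B (n - 1)).map (cohIsoPlus hB).toLinearMap = HPlusDeg g n := by
  refine Submodule.map_injective_of_injective (HPlus g).injective_subtype ?_
  rw [← Submodule.map_comp]
  change (HCycDeg B (n - 1)).map (cohPhi hB) = _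
  rw [map_cohPhi, HPlusDeg]
  split_ifs with hn
  · rw [Submodule.map_comap_subtype, inf_eq_right.mpr (HTrivDeg_le_HPlus hn)]
  · rw [Submodule.map_bot]

/-- The image H₊ of Φ meets H⁰ trivially, and every closed form becomes a form without constant
term, still closed, after subtraction of a constant. -/
theorem mkQ_cohPhi_bijective : Function.Bijective ((HTrivDeg g 0).mkQ ∘ₗ cohPhi hB) := by
  constructor
  · rw [← LinearMap.ker_eq_bot, LinearMap.ker_eq_bot']
    intro x hx
    have h0 : cohPhi hB x ∈ HTrivDeg g 0 := (Submodule.Quotient.mk_eq_zero _).mp hx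
    have hp : cohPhi hB x ∈ HPlus g := by
      rw [← range_cohPhi hB]
      exact ⟨x, rfl⟩
    exact cohPhi_injective hB ((eq_zero_of_mem_HPlus hp h0).trans (map_zero _).symm)
  · intro y
    obtain ⟨a, ha, rfl⟩ := exists_quotCls y
    have h : dTriv g (Phi B (PhiInv B hB.nondegenerate a)) = 0 := by rw [dTriv_Phi_PhiInv hB, ha]
    refine ⟨cls _ _ ⟨PhiInv B hB.nondegenerate a, (mem_cocycles_cyc_iff hB _).mpr h⟩, ?_⟩
    exact (quotCls_eq ha h (sub_Phi_PhiInv_mem hB.nondegenerate a)).symm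

/-- The isomorphism from the cyclic cohomology to the cohomology modulo constants. -/
def cohIsoQuot : HCyc B ≃ₗ[ℂ] HQuot g :=
  LinearEquiv.ofBijective _ (mkQ_cohPhi_bijective hB)

theorem cohIsoQuot_cls (c : cocycles (cycIncl B) (dAd g)) :
    cohIsoQuot hB (cls _ _ c) = quotCls (Phi B (c : Cyc B)) (dTriv_Phi hB c) := rfl

theorem map_cohIsoQuot (n : ℤ) :
    (HCycDeg B (n + 1)).map (cohIsoQuot hB).toLinearMap = HQuotDeg g (n + 2) := by
  change (HCycDeg B (n + 1)).map ((HTrivDeg g 0).mkQ ∘ₗ cohPhi hB) = _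
  rw [Submodule.map_comp, show n + 1 = n + 2 - 1 by ring, map_cohPhi]
  split_ifs with hn
  · rfl
  · rw [Submodule.map_bot, HQuotDeg_of_nonpos (by omega)]

/-- The wedge product on the cyclic cohomology. -/
def wedgeC : HCyc B →ₗ[ℂ] HCyc B →ₗ[ℂ] HCyc B :=
  ((wedgeP hB).compl₁₂ (cohIsoPlus hB).toLinearMap (cohIsoPlus hB).toLinearMap).compr₂
    (cohIsoPlus hB).symm.toLinearMap

theorem cohIsoPlus_wedgeC (x y : HCyc B) :
    cohIsoPlus hB (wedgeC hB x y) = wedgeP hB (cohIsoPlus hB x) (cohIsoPlus hB y) :=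
  (cohIsoPlus hB).apply_symm_apply _

/-- The Gerstenhaber bracket on the cyclic cohomology. -/
def brC : HCyc B →ₗ[ℂ] HCyc B →ₗ[ℂ] HCyc B :=
  ((brQ hB).compl₁₂ (cohIsoQuot hB).toLinearMap (cohIsoQuot hB).toLinearMap).compr₂
    (cohIsoQuot hB).symm.toLinearMap

theorem cohIsoQuot_brC (x y : HCyc B) :
    cohIsoQuot hB (brC hB x y) = brQ hB (cohIsoQuot hB x) (cohIsoQuot hB y) :=
  (cohIsoQuot hB).apply_symm_apply _

/-- The wedge of two forms in the image of Φ has no constant term, so applying Φ⁻¹ and then Φ gives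
it back, and the product can be compared in H₊. -/
theorem induces_wedgeC : Induces (cycIncl B) (dAd g)
    ((cycWedge B hB.nondegenerate).compr₂ (cycIncl B)) (wedgeC hB) := by
  intro a b
  have h0 : ev0 (wedge (Phi B (a : Cyc B)) (Phi B (b : Cyc B))) = 0 := by
    rw [ev0_wedge, ev0_Phi, zero_mul]
  obtain ⟨c, hc, hc'⟩ := exists_cohPhi_eq hB
    (dTriv_wedge_eq_zero hB (dTriv_Phi hB a) (dTriv_Phi hB b)) h0
  refine ⟨c, by rw [hc]; rfl, (cohIsoPlus hB).injective (Subtype.ext ?_)⟩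
  rw [cohIsoPlus_wedgeC, coe_wedgeP, coe_cohIsoPlus, coe_cohIsoPlus, coe_cohIsoPlus, hc',
    cohPhi_cls, cohPhi_cls, wedgeH_formCls]

/-- The Poisson bracket of forms in the image of Φ may have a constant term, which Φ⁻¹ discards; the
comparison is therefore made modulo constants. -/
theorem induces_brC : Induces (cycIncl B) (dAd g)
    (gerstenhaber.compl₁₂ (cycIncl B) (cycIncl B)) (brC hB) := by
  intro a b
  have hd := dTriv_superPoisson_eq_zero hB (dTriv_Phi hB a) (dTriv_Phi hB b)
  have h : dTriv g (Phi B (PhiInv B hB.nondegenerate (superPoisson B hB.nondegenerate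
      (Phi B (a : Cyc B)) (Phi B (b : Cyc B))))) = 0 := by
    rw [dTriv_Phi_PhiInv hB, hd]
  refine ⟨⟨_, (mem_cocycles_cyc_iff hB _).mpr h⟩,
    (gerstenhaber_cycIncl B hB.symm hB.nondegenerate _ _).symm, (cohIsoQuot hB).injective ?_⟩
  rw [cohIsoQuot_brC, cohIsoQuot_cls, cohIsoQuot_cls, cohIsoQuot_cls, brQ_quotCls]
  exact quotCls_eq _ _ (sub_Phi_PhiInv_mem hB.nondegenerate _)

end CyclicComplex

end QuadraticLie

end

open QuadraticLie in
theorem proposition5p4 {g : Type*} [LieRing g] [LieAlgebra ℂ g] [FiniteDimensional ℂ g]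
    (B : LinearMap.BilinForm ℂ g) (hB : IsQuadratic g B) :
    -- `(C_c(g), d)` and `(Λ g, ∂)` are complexes
    IsSubcomplex (cycIncl B) (dAd g) ∧
    IsSubcomplex (LinearMap.id : Alt g ℂ →ₗ[ℂ] Alt g ℂ) (dTriv g) ∧
    -- the operations on cochains induce operations on the cohomologies, namely
    -- the wedge product and the Gerstenhaber bracket on `H_c*(g)`,
    ∃ (wedgeC brC : HCyc B →ₗ[ℂ] HCyc B →ₗ[ℂ] HCyc B)
      -- the wedge product and the super Poisson bracket on `H*(g)`,
      (wedgeH brH : HTriv g →ₗ[ℂ] HTriv g →ₗ[ℂ] HTriv g)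
      -- the wedge product on `H₊*(g)`, and the bracket on `H_Q*(g)`
      (wedgeP : HPlus g →ₗ[ℂ] HPlus g →ₗ[ℂ] HPlus g)
      (brQ : HQuot g →ₗ[ℂ] HQuot g →ₗ[ℂ] HQuot g),
      Induces (cycIncl B) (dAd g) ((cycWedge B hB.nondegenerate).compr₂ (cycIncl B)) wedgeC ∧
      Induces (cycIncl B) (dAd g) (gerstenhaber.compl₁₂ (cycIncl B) (cycIncl B)) brC ∧
      Induces LinearMap.id (dTriv g) wedge wedgeH ∧
      Induces LinearMap.id (dTriv g) (superPoisson B hB.nondegenerate) brH ∧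
      (∀ x y : HPlus g, (wedgeP x y : HTriv g) = wedgeH x y) ∧
      (∀ x y : HTriv g, brQ (Submodule.Quotient.mk x) (Submodule.Quotient.mk y) =
        Submodule.Quotient.mk (brH x y)) ∧
      -- with the shifts `H_c*(g)[-1]`, `H_c*(g)[1]` and `H_Q*(g)[2]` of the gradings, they are
      -- graded associative algebras and graded Lie algebras, respectively,
      IsGradedAssoc (fun n => HCycDeg B (n - 1)) wedgeC ∧
      IsGradedAssoc (HPlusDeg g) wedgeP ∧
      IsGradedLie (fun n => HCycDeg B (n + 1)) brC ∧
      IsGradedLie (fun n => HQuotDeg g (n + 2)) brQ ∧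
      -- and these are isomorphic, through the maps that `Φ` induces
      ∃ (phi : HCyc B ≃ₗ[ℂ] HPlus g) (psi : HCyc B ≃ₗ[ℂ] HQuot g),
        (∀ c : cocycles (cycIncl B) (dAd g),
          ∃ ω : cocycles (LinearMap.id : Alt g ℂ →ₗ[ℂ] Alt g ℂ) (dTriv g),
            (ω : Alt g ℂ) = Phi B c ∧
            (phi (cls _ _ c) : HTriv g) = cls _ _ ω ∧
            psi (cls _ _ c) = Submodule.Quotient.mk (cls _ _ ω)) ∧
        IsGradedIso (fun n => HCycDeg B (n - 1)) wedgeC (HPlusDeg g) wedgeP phi ∧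
        IsGradedIso (fun n => HCycDeg B (n + 1)) brC (fun n => HQuotDeg g (n + 2)) brQ psi := by
  refine ⟨isSubcomplex_cyc hB, ⟨fun c => ⟨_, rfl⟩, dTriv_dTriv⟩, wedgeC hB, brC hB, wedgeH hB, brH hB,
    wedgeP hB, brQ hB, induces_wedgeC hB, induces_brC hB,
    fun a b => ⟨⟨_, dTriv_wedge_eq_zero hB a.2 b.2⟩, rfl, wedgeH_formCls hB a.2 b.2⟩,
    fun a b => ⟨⟨_, dTriv_superPoisson_eq_zero hB a.2 b.2⟩, rfl, brH_formCls hB a.2 b.2⟩,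
    coe_wedgeP hB, brQ_mk hB,
    isGradedAssoc_of_equiv (map_cohIsoPlus hB) (cohIsoPlus_wedgeC hB) (isGradedAssoc_wedgeP hB),
    isGradedAssoc_wedgeP hB,
    isGradedLie_of_equiv (map_cohIsoQuot hB) (cohIsoQuot_brC hB) (isGradedLie_brQ hB),
    isGradedLie_brQ hB, cohIsoPlus hB, cohIsoQuot hB, fun c => ⟨⟨_, dTriv_Phi hB c⟩, rfl, rfl, rfl⟩,
    ⟨map_cohIsoPlus hB, cohIsoPlus_wedgeC hB⟩, ⟨map_cohIsoQuot hB, cohIsoQuot_brC hB⟩⟩
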